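/- **Setting.** Calorically perfect gas with gas constant $R>0$, ratio of specific heats $\gamma>1$, $c_v=R/(\gamma-1)$, $c_P=\gamma R/(\gamma-1)$, nonnegative viscosity $\mu(T)$ and heat conductivity $\kappa(T)$. The conservative variables are $U=(\rho,\rho V,\rho E)$ with $E=c_vT+\tfrac12|V|^2$; $\nu=(\rho,V,T)$; $s=c_v\log T-R\log\rho+s_0$; the mathematical entropy is $\mathcal S=-\rho s$, with entropy variables $w=\partial\mathcal S/\partial U$ and entropy flux $F_m=-\rho sV_m$; $\psi_m=w^\top f_m-F_m$, where $f_m$ is the inviscid flux in direction $x_m$. A state is admissible if $\rho>0$ and $T>0$. Subscripts $L,H,A,G$ denote logarithmic, harmonic, arithmetic and geometric means of two states. **Grid and operators.** The domain is covered by $K$ hexahedral elements, each carrying $(p+1)^3$ tensor-product solution points, $p\ge1$, with one-dimensional points $\xi_0<\dots<\xi_p$ (e.g. Legendre–Gauss–Lobatto) and a diagonal-norm SBP operator $D=P^{-1}Q$, $P$ diagonal and positive, with $P_i=P_{p-i}$, $Q+Q^\top=\mathrm{diag}(-1,0,\dots,0,1)$, $D\mathbf 1=0$. The Jacobian $J$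 is positive and static; the discrete metric vectors $\hat a^l$ ($\approx J\nabla\xi^l$) satisfy the discrete geometric conservation law $\sum_lD_{\xi^l}\hat a^l_m=0$, $m=1,2,3$. Points of adjacent element faces are matched one to one with equal surface weights, and the scaled outward normals $n=\pm\hat a^l$ of matched points are opposite; unmatched face points form the domain boundary. On each grid line, $\Delta$ is the difference operator from flux points to solution points, the metric at the interior flux point $\bar i$ is $\bar a^l_{\bar i}=\sum_{r>i}\sum_{s\le i}2q_{sr}\tfrac12(\hat a^l_s+\hat a^l_r)$, where $i$ is the solution point preceding $\bar i$, and $\bar a^l=\hat a^l$ at the two end flux points. **Scheme.** With $\hat U=JU$, $$\hat U_t+\sum_{l=1}^3\Big(P_{\xi^l}^{-1}\Delta_{\xi^l}\big[\bar f^{(EC)}_l-\bar f^{(ED)}_l-\bar f^{(AD_1)}_{\bar\sigma,l}-\bar f^{(AD_1)}_l\big]-D_{\xi^l}f^{(v)}_l\Big)=\sum_{l=1}^3P_{\xi^l}^{-1}\big[g_l+g^{(AD_1)}_l\big].$$ 1. $\bar f^{(EC)}_l=f_S(u_1,u_2)\,\bar a^l$ at interior flux points, $u_1,u_2$ being the states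 at the neighbouring solution points, and $f_S(u,u)\,\hat a^l$ at the end flux points. Here $f_S$ is any consistent, symmetric two-point flux with $(w_1-w_2)^\top f_{S,m}(u_1,u_2)=\psi_m(u_1)-\psi_m(u_2)$ for admissible $u_1,u_2$ (for example Chandrashekar's flux). 2. Merriam–Roe dissipation: $\bar f^{(ED)}_l=M(u_1,u_2,\bar a^l)(w_2-w_1)$ at interior flux points and $0$ at the end flux points. Here $M(u_1,u_2,n)=\tfrac12\mathcal Y|\lambda|\mathcal Y^\top$, where $\mathcal Y$ holds the eigenvectors of the inviscid flux Jacobian in direction $n$, normalised by $\partial U/\partial w=\mathcal Y\mathcal Y^\top$, and $\lambda=\mathrm{diag}(V\cdot n-c\|n\|,\,V\cdot n+c\|n\|,\,V\cdot n,\,V\cdot n,\,V\cdot n)$ with $c=\sqrt{\gamma RT}$; all are taken at the state $(\rho_L,(V_1T_2+V_2T_1)/(T_1+T_2),T_H)$. 3. Brenner-type dissipation: for $\bar n=n/\|n\|$ (and $\bar n=0$ if $n=0$), $\mathcal N_{ij}=\delta_{ij}+\bar n_i\bar n_j/3$ and $E_{avg}=\frac{T_G^2}{T_L}\frac R{\gamma-1}+\tfrac12V_1\cdot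 V_2$, let $$c_\nu(u_1,u_2,n;\sigma,\mu,\kappa)=\|n\|^2\begin{pmatrix}\sigma&0&0\\ \sigma V_A&\mu\mathcal N&0\\ \sigma E_{avg}&\mu(\mathcal NV_A)^\top&\kappa\end{pmatrix}.$$ At interior flux points $\bar f^{(AD_1)}_l=c_\nu(u_1,u_2,\bar a^l;\,c_\rho\mu^{AD},\mu^{AD},c_T\mu^{AD})\,\dfrac{\nu_2-\nu_1}{\sqrt{J_1J_2}\,\Delta\xi}$, and $\bar f^{(AD_1)}_{\bar\sigma,l}$ is the same expression with $(\sigma,\mu,\kappa)=(\bar\sigma,0,0)$; both vanish at the end flux points. Here $c_\rho,c_T>0$, the nodal values of $\mu^{AD}$ are nonnegative and are averaged arithmetically to flux points and interfaces, and $\bar\sigma\ge0$ is given at flux points. At a face point with state $u^-$ and outward normal $n$, matched with a point of state $u^+$, $g^{(AD_1)}=c_\nu(u^-,u^+,n;\,c_\rho\mu^{AD},\mu^{AD},c_T\mu^{AD})\,\dfrac{\nu^+-\nu^-}{\sqrt{J^-J^+}\,P_{0}}$. 4. Viscous terms: $\Theta_{\xi^l}=D_{\xi^l}w+P_{\xi^l}^{-1}g^\Theta_l$,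 $\Theta_{x_j}=J^{-1}\sum_l\hat a^l_j\Theta_{\xi^l}$, $f^{(v)}_l=\sum_m\hat a^l_m\sum_jc_{mj}(u)\Theta_{x_j}$, where $\sum_jc_{mj}\,\partial_{x_j}w$ is the Navier–Stokes viscous flux $\big(0,\tau_{1m},\tau_{2m},\tau_{3m},\sum_i\tau_{im}V_i+\kappa\,\partial_{x_m}T\big)$. 5. SAT penalties at a matched face point, with $\phi^\pm$ the viscous fluxes in the respective outward normal directions and $\delta=w^+-w^-$: $g^\Theta=\pm\tfrac{1-\alpha}2\,\delta$ (sign $+$ at the last and $-$ at the first point of a line), and $$g=\Big[\sum_mn_mf_m(u^-)-\big(f_S(u^-,u^+)\,n-M(u^-,u^+,n)\,\delta\big)\Big]-\tfrac{1+\alpha}2(\phi^-+\phi^+)+\tfrac\beta2\sum_{m,j}n_mn_j\Big(\tfrac{c_{mj}(u^-)}{J^-}+\tfrac{c_{mj}(u^+)}{J^+}\Big)\delta,$$ where $\alpha\in\mathbb R$ takes opposite values on the two sides of an interface and $\beta\ge0$ takes the same value on both sides. At points of the domain boundary the boundary conditions are imposed by a solution penalty $g^b$ (in place of $g+g^{(AD_1)}$)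 and a gradient penalty $\pm\theta^b$ (in place of $g^\Theta$). They are assumed to be entropy stable: at every time $$\sum_{\text{boundary points}}P_\perp\Big(-\sum_mn_mF_m+w^\top(\phi+g^b)+(\theta^b)^\top\phi\Big)\le0,$$ where $P_\perp$ is the surface weight (this is vacuous when there is no boundary). **Theorem.** The semi-discrete first-order scheme is entropy stable. That is, if $U$ solves the scheme on a time interval $I$ and all its nodal states are admissible, then the discrete integral of the entropy $\sum_{k}\sum_{ijl}P_{ijl}\,J\,\mathcal S(U)$ over all elements is differentiable on $I$ with $$\frac{d}{dt}\sum_{k=1}^K\sum_{i,j,l}P_{ijl}\,J_{k,ijl}\,\mathcal S(U_{k,ijl}(t))\le0,$$ and it is non-increasing on $I$. -/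

import Mathlib

open Matrix

noncomputable section

namespace NSScheme

abbrev V3 := Fin 3 → ℝ

abbrev V5 := Fin 5 → ℝ

/-- The five-component vector with first entry `a`, three middle entries `v`, last entry `b`. -/
def vec5 (a : ℝ) (v : V3) (b : ℝ) : V5 := ![a, v 0, v 1, v 2, b]

/-- The position (1, 2 or 3) of the `i`-th Cartesian component inside a five-component vector. -/
def mid (i : Fin 3) : Fin 5 := i.succ.castSucc

/-- Euclidean length of a vector in `ℝ³`. -/
def len (n : V3) : ℝ := Real.sqrt (n ⬝ᵥ n)

/-- The unit vector in the direction of `n` (and `0` if `n = 0`). -/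
def unit (n : V3) : V3 := (len n)⁻¹ • n

/-! ## Averages of two positive numbers -/

def logMean (x y : ℝ) : ℝ := if x = y then x else (x - y) / (Real.log x - Real.log y)

def harmMean (x y : ℝ) : ℝ := 2 * x * y / (x + y)

def geomMean (x y : ℝ) : ℝ := Real.sqrt (x * y)

/-! ## The calorically perfect viscous gas -/

/-- Gas constant `R`, ratio of specific heats `γ`, reference value `s₀` of the thermodynamic
entropy, dynamic viscosity `μ(T)` and thermal conductivity `κ(T)`. -/
structure Gas where
  R : ℝ
  γ : ℝ
  s₀ : ℝ
  μ : ℝ → ℝ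
  κ : ℝ → ℝ
  R_pos : 0 < R
  one_lt_γ : 1 < γ
  μ_nonneg : ∀ T, 0 < T → 0 ≤ μ T
  κ_nonneg : ∀ T, 0 < T → 0 ≤ κ T

/-- Velocity of the conservative state `u = (ρ, ρV₁, ρV₂, ρV₃, ρE)`. -/
def vel (u : V5) : V3 := fun i => u (mid i) / u 0

namespace Gas

variable (G : Gas)

/-- Specific heat at constant volume. -/
def cv : ℝ := G.R / (G.γ - 1)

/-- Specific heat at constant pressure. -/
def cP : ℝ := G.γ * G.R / (G.γ - 1)

/-- Temperature, from `E = c_v T + |V|² / 2`. -/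
def temp (u : V5) : ℝ := (u 4 / u 0 - (vel u ⬝ᵥ vel u) / 2) / G.cv

/-- Positive density and positive temperature. -/
def Admissible (u : V5) : Prop := 0 < u 0 ∧ 0 < G.temp u

def pressure (u : V5) : ℝ := u 0 * G.R * G.temp u

/-- Total enthalpy `H = c_P T + |V|² / 2` for given velocity and temperature. -/
def enthalpy (V : V3) (T : ℝ) : ℝ := G.cP * T + (V ⬝ᵥ V) / 2

/-- Thermodynamic entropy `s`. -/
def thermoEntropy (u : V5) : ℝ :=
  G.cv * Real.log (G.temp u) - G.R * Real.log (u 0) + G.s₀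

/-- Mathematical entropy `𝒮 = -ρ s`. -/
def entropy (u : V5) : ℝ := -(u 0) * G.thermoEntropy u

/-- Entropy variables `w = ∂𝒮/∂U`. -/
def entropyVar (u : V5) : V5 :=
  vec5 (G.cP - G.thermoEntropy u - (vel u ⬝ᵥ vel u) / (2 * G.temp u))
    ((G.temp u)⁻¹ • vel u) (-(G.temp u)⁻¹)

/-- Primitive variables `ν = (ρ, V, T)`. -/
def prim (u : V5) : V5 := vec5 (u 0) (vel u) (G.temp u)

/-- Inviscid flux in the `m`-th Cartesian direction. -/
def invFlux (u : V5) (m : Fin 3) : V5 :=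
  vec5 (u 0 * vel u m)
    (fun i => u 0 * vel u m * vel u i + if m = i then G.pressure u else 0)
    (u 0 * vel u m * G.enthalpy (vel u) (G.temp u))

/-- Entropy flux `-ρ s V_m`. -/
def entropyFlux (u : V5) (m : Fin 3) : ℝ := -(u 0) * G.thermoEntropy u * vel u m

/-- Entropy flux potential `ψ_m = wᵀ f_m - F_m`. -/
def potential (u : V5) (m : Fin 3) : ℝ :=
  G.entropyVar u ⬝ᵥ G.invFlux u m - G.entropyFlux u m

/-! ### Physical viscous flux as a function of the gradient of the entropy variables -/

/-- `∂T/∂x_j` when the entropy variables have gradient `Θ` (`Θ j = ∂w/∂x_j`). -/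
def gradT (u : V5) (Θ : Fin 3 → V5) (j : Fin 3) : ℝ := G.temp u ^ 2 * Θ j 4

/-- `∂V_i/∂x_j` when the entropy variables have gradient `Θ`. -/
def gradV (u : V5) (Θ : Fin 3 → V5) (i j : Fin 3) : ℝ :=
  G.temp u * (Θ j (mid i) + vel u i * Θ j 4)

/-- Viscous stress `τ_{ij}`. -/
def stress (u : V5) (Θ : Fin 3 → V5) (i j : Fin 3) : ℝ :=
  G.μ (G.temp u) * (G.gradV u Θ i j + G.gradV u Θ j i
    - if i = j then 2 / 3 * ∑ n, G.gradV u Θ n n else 0)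

/-- Viscous flux in the `m`-th Cartesian direction; it is the linear map
`Θ ↦ ∑ j, c_{m,j}(u) Θ_j` given by the viscous coefficient matrices. -/
def viscFlux (u : V5) (Θ : Fin 3 → V5) (m : Fin 3) : V5 :=
  vec5 0 (fun i => G.stress u Θ i m)
    (∑ i, G.stress u Θ i m * vel u i + G.κ (G.temp u) * G.gradT u Θ m)

/-! ### Brenner-type two-point dissipation -/

/-- The average `E_avg` of two states. -/
def Eavg (u₁ u₂ : V5) : ℝ :=
  geomMean (G.temp u₁) (G.temp u₂) ^ 2 / logMean (G.temp u₁) (G.temp u₂) * (G.R / (G.γ - 1))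
    + (vel u₁ ⬝ᵥ vel u₂) / 2

/-- The matrix `c_ν^{(B)}(u₁, u₂, n)` with diffusion coefficients `σ`, `μ`, `κ`. -/
def brenner (u₁ u₂ : V5) (n : V3) (σ μ κ : ℝ) : Matrix (Fin 5) (Fin 5) ℝ :=
  let VA : V3 := (1 / 2 : ℝ) • (vel u₁ + vel u₂)
  let nb : V3 := unit n
  let row (i : Fin 3) : V5 :=
    vec5 (σ * VA i) (fun j => μ * ((if i = j then 1 else 0) + nb i * nb j / 3)) 0
  (len n ^ 2) • Matrix.of ![
    vec5 σ 0 0,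
    row 0,
    row 1,
    row 2,
    vec5 (σ * G.Eavg u₁ u₂) (fun j => μ * (VA j + nb j / 3 * (VA ⬝ᵥ nb))) κ]

/-! ### Merriam–Roe dissipation -/

/-- The matrix `𝒴` of scaled eigenvectors (as columns) of the inviscid flux Jacobian in the
direction `n` at the state with density `ρ`, velocity `V`, temperature `T`, normalised so that
`∂U/∂W = 𝒴 𝒴ᵀ`. First the two acoustic vectors, then three vectors for the eigenvalue `V · n`. -/
def eigY (ρ : ℝ) (V : V3) (T : ℝ) (n : V3) : Matrix (Fin 5) (Fin 5) ℝ :=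
  let nb : V3 := unit n
  let c : ℝ := Real.sqrt (G.γ * G.R * T)
  let ac (s : ℝ) : V5 := Real.sqrt (ρ / (2 * G.γ * G.R)) •
    vec5 1 (V + (s * c) • nb) (G.enthalpy V T + s * c * (V ⬝ᵥ nb))
  let lin (k : Fin 3) : V5 :=
    (Real.sqrt ((G.γ - 1) * ρ / (G.γ * G.R)) * nb k) • vec5 1 V ((V ⬝ᵥ V) / 2)
      + Real.sqrt (ρ * T) •
        vec5 0 (crossProduct nb (Pi.single k 1)) (V ⬝ᵥ crossProduct nb (Pi.single k 1))
  (Matrix.of ![ac (-1), ac 1, lin 0, lin 1, lin 2])ᵀ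

/-- The eigenvalues belonging to the columns of `eigY`. -/
def eigVal (V : V3) (T : ℝ) (n : V3) : V5 :=
  let c : ℝ := Real.sqrt (G.γ * G.R * T)
  ![V ⬝ᵥ n - c * len n, V ⬝ᵥ n + c * len n, V ⬝ᵥ n, V ⬝ᵥ n, V ⬝ᵥ n]

/-- The matrix `M^𝒴(u₁, u₂, n) = ½ 𝒴 |λ| 𝒴ᵀ` at the average state
`(ρ_L, (V₁T₂ + V₂T₁)/(T₁ + T₂), T_H)`. -/
def roeMatrix (u₁ u₂ : V5) (n : V3) : Matrix (Fin 5) (Fin 5) ℝ :=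
  let T₁ := G.temp u₁
  let T₂ := G.temp u₂
  let ρ := logMean (u₁ 0) (u₂ 0)
  let V : V3 := (T₁ + T₂)⁻¹ • (T₂ • vel u₁ + T₁ • vel u₂)
  let T := harmMean T₁ T₂
  (1 / 2 : ℝ) • (G.eigY ρ V T n * Matrix.diagonal (fun i => |G.eigVal V T n i|)
    * (G.eigY ρ V T n)ᵀ)

end Gas

/-- A consistent, symmetric two-point entropy conservative inviscid flux: `flux u₁ u₂ m` is the
component in the `m`-th Cartesian direction. -/
structure TwoPointFlux (G : Gas) where
  flux : V5 → V5 → Fin 3 → V5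
  symm : ∀ u₁ u₂, G.Admissible u₁ → G.Admissible u₂ → ∀ m, flux u₁ u₂ m = flux u₂ u₁ m
  consistent : ∀ u, G.Admissible u → ∀ m, flux u u m = G.invFlux u m
  conservative : ∀ u₁ u₂, G.Admissible u₁ → G.Admissible u₂ → ∀ m,
    (G.entropyVar u₁ - G.entropyVar u₂) ⬝ᵥ flux u₁ u₂ m = G.potential u₁ m - G.potential u₂ m

theorem logMean_mul {x y : ℝ} (hx : 0 < x) (hy : 0 < y) :
    logMean x y * (Real.log x - Real.log y) = x - y := by
  unfold logMean
  split_ifs with h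
  · subst h; simp
  · have : Real.log x - Real.log y ≠ 0 := fun h' =>
      h (Real.log_injOn_pos hx hy (sub_eq_zero.mp h'))
    field_simp

theorem logMean_pos {x y : ℝ} (hx : 0 < x) (hy : 0 < y) : 0 < logMean x y := by
  unfold logMean
  split_ifs with h
  · exact hx
  · rcases lt_or_gt_of_ne h with h | h
    · exact div_pos_of_neg_of_neg (by linarith) (by linarith [Real.log_lt_log hx h])
    · exact div_pos (by linarith) (by linarith [Real.log_lt_log hy h])

theorem logMean_comm (x y : ℝ) : logMean x y = logMean y x := by
  unfold logMean
  by_cases h : x = y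
  · simp [h]
  · rw [if_neg h, if_neg (Ne.symm h), ← neg_sub y x, ← neg_sub (Real.log y), neg_div_neg_eq]

namespace Gas

variable (G : Gas)

/-- The inverse temperature `1 / (2 R T)`. -/
def invTemp (u : V5) : ℝ := (2 * G.R * G.temp u)⁻¹

/-- The kinetic energy preserving and entropy conservative flux of Chandrashekar. -/
def chandFlux (u₁ u₂ : V5) (m : Fin 3) : V5 :=
  let b₁ := G.invTemp u₁
  let b₂ := G.invTemp u₂
  let VA : V3 := (1 / 2 : ℝ) • (vel u₁ + vel u₂)
  let P := (u₁ 0 + u₂ 0) / (2 * (b₁ + b₂))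
  let f₀ := logMean (u₁ 0) (u₂ 0) * VA m
  let f : V3 := fun i => f₀ * VA i + if m = i then P else 0
  vec5 f₀ f
    ((1 / (2 * (G.γ - 1) * logMean b₁ b₂)
      - (vel u₁ ⬝ᵥ vel u₁ + vel u₂ ⬝ᵥ vel u₂) / 4) * f₀ + VA ⬝ᵥ f)

theorem potential_eq {u : V5} (hu : G.Admissible u) (m : Fin 3) :
    G.potential u m = u 0 * G.R * vel u m := by
  have hT := hu.2.ne'
  unfold potential entropyVar invFlux entropyFlux enthalpy pressure
  generalize G.temp u = T at *
  generalize G.thermoEntropy u = s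
  generalize vel u = V
  generalize u 0 = r
  fin_cases m <;>
    simp [vec5, dotProduct, Fin.sum_univ_succ] <;> field_simp <;> ring

end Gas

/-- Chandrashekar's flux is a two-point entropy conservative flux. -/
def chandrashekar (G : Gas) : TwoPointFlux G where
  flux := G.chandFlux
  symm := by
    intro u₁ u₂ _ _ m
    unfold Gas.chandFlux
    dsimp only
    rw [logMean_comm (u₁ 0), logMean_comm (G.invTemp u₁), add_comm (vel u₁), add_comm (u₁ 0),
      add_comm (G.invTemp u₁), add_comm (vel u₁ ⬝ᵥ vel u₁)]
  consistent := by
    intro u hu m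
    have hT := hu.2.ne'
    have hR := G.R_pos.ne'
    have hg : G.γ - 1 ≠ 0 := (sub_pos.mpr G.one_lt_γ).ne'
    unfold Gas.chandFlux Gas.invFlux Gas.enthalpy Gas.pressure Gas.invTemp Gas.cP
    simp only [logMean, if_true]
    generalize G.temp u = T at *
    generalize vel u = V
    generalize u 0 = r
    funext i
    fin_cases m <;> fin_cases i <;>
      simp [vec5, dotProduct, Fin.sum_univ_succ, -mul_eq_mul_left_iff, -mul_eq_mul_right_iff] <;> field_simp <;> ring
  conservative := by
    intro u₁ u₂ h₁ h₂ m
    rw [G.potential_eq h₁, G.potential_eq h₂]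
    have hR := G.R_pos
    have hg : 0 < G.γ - 1 := sub_pos.mpr G.one_lt_γ
    have hb₁ : 0 < G.invTemp u₁ := inv_pos.mpr (by have := h₁.2; positivity)
    have hb₂ : 0 < G.invTemp u₂ := inv_pos.mpr (by have := h₂.2; positivity)
    have ht : ∀ u, 0 < G.invTemp u → (G.temp u)⁻¹ = 2 * G.R * G.invTemp u := by
      intro u _
      unfold Gas.invTemp
      rw [mul_inv, ← mul_assoc, mul_inv_cancel₀ (by positivity), one_mul]
    have hl : ∀ u, G.Admissible u →
        Real.log (G.temp u) = -Real.log (G.invTemp u) - Real.log (2 * G.R) := by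
      intro u hu
      unfold Gas.invTemp
      rw [Real.log_inv, Real.log_mul (by positivity) hu.2.ne']
      ring
    have hw : ∀ u, G.Admissible u → 0 < G.invTemp u → G.entropyVar u =
        vec5 (G.cP + G.R / (G.γ - 1) * (Real.log (G.invTemp u) + Real.log (2 * G.R))
          + G.R * Real.log (u 0) - G.s₀ - G.R * G.invTemp u * (vel u ⬝ᵥ vel u))
          ((2 * G.R * G.invTemp u) • vel u) (-(2 * G.R * G.invTemp u)) := by
      intro u hu hb
      unfold Gas.entropyVar Gas.thermoEntropy
      rw [ht u hb, hl u hu, div_eq_mul_inv, mul_inv, ht u hb]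
      unfold Gas.cv
      congr 1
      ring
    rw [hw u₁ h₁ hb₁, hw u₂ h₂ hb₂]
    unfold Gas.chandFlux
    dsimp only
    have e₁ := logMean_mul h₁.1 h₂.1
    have e₂ := logMean_mul hb₁ hb₂
    have p₂ := logMean_pos hb₁ hb₂
    generalize logMean (u₁ 0) (u₂ 0) = rL at *
    generalize logMean (G.invTemp u₁) (G.invTemp u₂) = bL at *
    generalize Real.log (G.invTemp u₁) = lb₁ at *
    generalize Real.log (G.invTemp u₂) = lb₂ at *
    generalize Real.log (u₁ 0) = lr₁ at *
    generalize Real.log (u₂ 0) = lr₂ at *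
    generalize G.invTemp u₁ = b₁ at *
    generalize G.invTemp u₂ = b₂ at *
    generalize vel u₁ = V₁ at *
    generalize vel u₂ = V₂ at *
    have hlb : lb₁ = lb₂ + (b₁ - b₂) / bL := by field_simp; linarith
    have hr : u₁ 0 = u₂ 0 + rL * (lr₁ - lr₂) := by linarith
    subst hlb
    rw [hr]
    generalize u₂ 0 = r
    have hb : b₁ + b₂ ≠ 0 := by positivity
    have hg' := hg.ne'
    generalize G.γ - 1 = g at *
    have hp₂ := p₂.ne'
    fin_cases m <;>
      simp [vec5, dotProduct, Fin.sum_univ_succ] <;> field_simp <;> ring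

/-- Contraction `f · n` of the two-point flux with a direction vector. -/
def TwoPointFlux.along {G : Gas} (f : TwoPointFlux G) (u₁ u₂ : V5) (n : V3) : V5 :=
  ∑ m, n m • f.flux u₁ u₂ m

/-! ## Summation-by-parts operators and the grid -/

/-- A one-dimensional diagonal-norm SBP operator `D = P⁻¹ Q` on `p + 1` points (for instance the
collocation operator of degree `p` on the Legendre–Gauss–Lobatto points, whose diagonal mass
matrix holds the LGL weights): `Q + Qᵀ = diag(-1, 0, …, 0, 1)`, and `D` annihilates constants. -/
structure SBP (p : ℕ) where
  node : Fin (p + 1) → ℝ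
  node_strictMono : StrictMono node
  P : Fin (p + 1) → ℝ
  P_pos : ∀ i, 0 < P i
  P_rev : ∀ i, P i.rev = P i
  Q : Matrix (Fin (p + 1)) (Fin (p + 1)) ℝ
  Q_add_transpose : Q + Qᵀ = Matrix.diagonal
    (fun i => (if i = Fin.last p then 1 else 0) - (if i = 0 then 1 else 0))
  Q_one : ∀ i, ∑ j, Q i j = 0

/-- The differentiation matrix. -/
def SBP.D {p : ℕ} (S : SBP p) (i j : Fin (p + 1)) : ℝ := (S.P i)⁻¹ * S.Q i j

/-- Solution points of one hexahedral element (tensor-product index). -/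
abbrev Node (p : ℕ) := Fin 3 → Fin (p + 1)

/-- Tensor-product derivative in the computational direction `l`. -/
def SBP.Dxi {p : ℕ} (S : SBP p) (l : Fin 3) (f : Node p → V5) (q : Node p) : V5 :=
  ∑ n, S.D (q l) n • f (Function.update q l n)

/-- The weight `P_{ijk}` of a solution point. -/
def SBP.vol {p : ℕ} (S : SBP p) (q : Node p) : ℝ := ∏ l, S.P (q l)

/-- The index of the first (`false`) or last (`true`) point of a grid line. -/
def endIdx (p : ℕ) : Bool → Fin (p + 1)
  | false => 0
  | true => Fin.last p

/-- Solution points regarded as points of an element face: element, computational direction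
normal to the face, side, and a solution point lying on that face. -/
abbrev FaceNode (K p : ℕ) :=
  {x : Fin K × Fin 3 × Bool × Node p // x.2.2.2 x.2.1 = endIdx p x.2.2.1}

namespace FaceNode

variable {K p : ℕ} (a : FaceNode K p)

def elem : Fin K := a.1.1
def dir : Fin 3 := a.1.2.1
def side : Bool := a.1.2.2.1
def node : Node p := a.1.2.2.2

/-- Sign of the outward direction: `+1` at the last point, `-1` at the first point. -/
def sgn : ℝ := if a.side then 1 else -1

/-- The surface weight `P_⊥` of a face point. -/
def weight (S : SBP p) : ℝ := ∏ l ∈ Finset.univ.erase a.dir, S.P (a.node l)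

end FaceNode

/-- A conforming unstructured hexahedral grid with `K` elements: positive Jacobian `J`, discrete
metric coefficients `a k l q m` (approximating `J ∂ξ^l/∂x^m` at the solution point `q` of the
element `k`) that satisfy the discrete geometric conservation laws, and the matching of the
coinciding face points of neighbouring elements (`nbr a = none` at the domain boundary).
Matched face points carry the same surface weight, and the metric coefficients are continuous
across the interface: the scaled outward normals are opposite. -/
structure Mesh {p : ℕ} (S : SBP p) (K : ℕ) where
  J : Fin K → Node p → ℝ
  J_pos : ∀ k q, 0 < J k q
  a : Fin K → Fin 3 → Node p → V3
  gcl : ∀ k q m, ∑ l, ∑ n, S.D (q l) n * a k l (Function.update q l n) m = 0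
  nbr : FaceNode K p → Option (FaceNode K p)
  nbr_ne : ∀ x y, nbr x = some y → x ≠ y
  nbr_symm : ∀ x y, nbr x = some y → nbr y = some x
  nbr_weight : ∀ x y, nbr x = some y → y.weight S = x.weight S
  nbr_normal : ∀ x y, nbr x = some y →
    y.sgn • a y.elem y.dir y.node = -(x.sgn • a x.elem x.dir x.node)

namespace Mesh

variable {p K : ℕ} {S : SBP p} (M : Mesh S K)

/-- Scaled outward normal at a face point. -/
def normal (x : FaceNode K p) : V3 := x.sgn • M.a x.elem x.dir x.node

/-- Metric coefficients at the interior flux point between the solution point `q` and its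
successor in the direction `l`. -/
def abar (k : Fin K) (l : Fin 3) (q : Node p) : V3 :=
  ∑ r ∈ Finset.Ioi (q l), ∑ s ∈ Finset.Iic (q l),
    (2 * S.Q s r) • (1 / 2 : ℝ) •
      (M.a k l (Function.update q l s) + M.a k l (Function.update q l r))

end Mesh

/-- Values of a flux at the flux points `0, …, p + 1` of the grid line through `q` in direction
`l`: `inner q₁ q₂` at the flux point between consecutive solution points `q₁`, `q₂`, and
`outer q'` at the two end flux points, `q'` being the end point of the line. -/
def lineFlux {p : ℕ} (l : Fin 3) (inner : Node p → Node p → V5) (outer : Node p → V5)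
    (q : Node p) (i : Fin (p + 2)) : V5 :=
  if h : 0 < i.val ∧ i.val < p + 1 then
    inner (Function.update q l ⟨i.val - 1, by omega⟩) (Function.update q l ⟨i.val, h.2⟩)
  else if i.val = 0 then outer (Function.update q l 0)
  else outer (Function.update q l (Fin.last p))

/-! ## The scheme -/

/-- Constant parameters: the Brenner coefficients `cρ`, `cT`, and on each interface the switch
`α` of the viscous penalties (opposite values seen from the two sides) and the coefficient `β`
of the interior penalty term. -/
structure Params {p K : ℕ} {S : SBP p} (M : Mesh S K) where
  cρ : ℝ
  cT : ℝ
  cρ_pos : 0 < cρ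
  cT_pos : 0 < cT
  α : FaceNode K p → ℝ
  α_antisymm : ∀ x y, M.nbr x = some y → α y = -α x
  β : FaceNode K p → ℝ
  β_nonneg : ∀ x, 0 ≤ β x
  β_symm : ∀ x y, M.nbr x = some y → β y = β x

/-- The remaining ingredients, at a fixed time: artificial viscosity `μAD` at the solution points,
the additional mass diffusion coefficient `σbar` at the interior flux points (`σbar k l q` belongs
to the flux point between `q` and its successor in direction `l`), and the boundary conditions,
imposed by a penalty `pen` on the solution and a penalty `gradPen` on the gradient of the
entropy variables (only their values at points of the domain boundary matter). -/
structure Fields (K p : ℕ) where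
  μAD : Fin K → Node p → ℝ
  μAD_nonneg : ∀ k q, 0 ≤ μAD k q
  σbar : Fin K → Fin 3 → Node p → ℝ
  σbar_nonneg : ∀ k l q, 0 ≤ σbar k l q
  pen : FaceNode K p → V5
  gradPen : FaceNode K p → V5

/-- A discrete solution: conservative variables at all solution points. -/
abbrev State (K p : ℕ) := Fin K → Node p → V5

section Scheme

variable (G : Gas) {p K : ℕ} {S : SBP p} (M : Mesh S K) (f : TwoPointFlux G) (C : Params M)
  (A : Fields K p) (U : State K p)

/-- The state at a face point. -/
def atFace (U : State K p) (x : FaceNode K p) : V5 := U x.elem x.node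

/-- `g` at the points of the two faces normal to direction `l`, and zero elsewhere. -/
def onFaces (g : FaceNode K p → V5) (k : Fin K) (l : Fin 3) (q : Node p) : V5 :=
  ∑ s : Bool, if h : q l = endIdx p s then g ⟨(k, l, s, q), h⟩ else 0

/-! ### Inviscid fluxes -/

/-- Entropy conservative flux at flux points. -/
def fluxEC (k : Fin K) (l : Fin 3) : Node p → Fin (p + 2) → V5 :=
  lineFlux l (fun q₁ q₂ => f.along (U k q₁) (U k q₂) (M.abar k l q₁))
    (fun q => f.along (U k q) (U k q) (M.a k l q))

/-- Merriam–Roe entropy dissipative flux at flux points. -/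
def fluxED (k : Fin K) (l : Fin 3) : Node p → Fin (p + 2) → V5 :=
  lineFlux l (fun q₁ q₂ => G.roeMatrix (U k q₁) (U k q₂) (M.abar k l q₁) *ᵥ
      (G.entropyVar (U k q₂) - G.entropyVar (U k q₁)))
    (fun _ => 0)

/-- Merriam–Roe flux of two states in the direction `n`. -/
def fluxMR (u₁ u₂ : V5) (n : V3) : V5 :=
  f.along u₁ u₂ n - G.roeMatrix u₁ u₂ n *ᵥ (G.entropyVar u₂ - G.entropyVar u₁)

/-! ### Artificial dissipation -/

/-- The jump `dν = (ν(u₂) - ν(u₁)) / √(J₂ J₁)`. -/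
def jumpPrim (u₁ u₂ : V5) (J₁ J₂ : ℝ) : V5 :=
  (Real.sqrt (J₂ * J₁))⁻¹ • (G.prim u₂ - G.prim u₁)

/-- Brenner-type artificial dissipation flux at flux points, with
`(σ, μ, κ) = (cρ, 1, cT) μAD` and `μAD` averaged arithmetically to the flux point. -/
def fluxAD (k : Fin K) (l : Fin 3) : Node p → Fin (p + 2) → V5 :=
  lineFlux l (fun q₁ q₂ =>
      let μ := (A.μAD k q₁ + A.μAD k q₂) / 2
      (S.node (q₂ l) - S.node (q₁ l))⁻¹ •
        (G.brenner (U k q₁) (U k q₂) (M.abar k l q₁) (C.cρ * μ) μ (C.cT * μ) *ᵥ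
          jumpPrim G (U k q₁) (U k q₂) (M.J k q₁) (M.J k q₂)))
    (fun _ => 0)

/-- Additional mass diffusion flux at flux points. -/
def fluxADσ (k : Fin K) (l : Fin 3) : Node p → Fin (p + 2) → V5 :=
  lineFlux l (fun q₁ q₂ =>
      (S.node (q₂ l) - S.node (q₁ l))⁻¹ •
        (G.brenner (U k q₁) (U k q₂) (M.abar k l q₁) (A.σbar k l q₁) 0 0 *ᵥ
          jumpPrim G (U k q₁) (U k q₂) (M.J k q₁) (M.J k q₂)))
    (fun _ => 0)

/-- Artificial dissipation penalty at a face point matched with `y`. -/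
def penAD (x y : FaceNode K p) : V5 :=
  let μ := (A.μAD x.elem x.node + A.μAD y.elem y.node) / 2
  (S.P (x.node x.dir))⁻¹ •
    (G.brenner (atFace U x) (atFace U y) (M.normal x) (C.cρ * μ) μ (C.cT * μ) *ᵥ
      jumpPrim G (atFace U x) (atFace U y) (M.J x.elem x.node) (M.J y.elem y.node))

/-! ### High-order viscous terms -/

/-- Penalty on the gradient of the entropy variables at a face point. -/
def penΘ (x : FaceNode K p) : V5 :=
  x.sgn • match M.nbr x with
    | some y => ((1 - C.α x) / 2) • (G.entropyVar (atFace U y) - G.entropyVar (atFace U x))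
    | none => A.gradPen x

/-- Penalised derivative of the entropy variables in the computational direction `l`. -/
def gradξ (k : Fin K) (l : Fin 3) (q : Node p) : V5 :=
  S.Dxi l (fun q' => G.entropyVar (U k q')) q
    + (S.P (q l))⁻¹ • onFaces (penΘ G M C A U) k l q

/-- Gradient of the entropy variables in Cartesian coordinates. -/
def gradx (k : Fin K) (q : Node p) (j : Fin 3) : V5 :=
  (M.J k q)⁻¹ • ∑ l, M.a k l q j • gradξ G M C A U k l q

/-- Contravariant viscous flux in the computational direction `l` at a solution point. -/
def fluxV (k : Fin K) (l : Fin 3) (q : Node p) : V5 :=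
  ∑ m, M.a k l q m • G.viscFlux (U k q) (gradx G M C A U k q) m

/-- Viscous flux in the outward normal direction at a face point. -/
def fluxVn (x : FaceNode K p) : V5 := x.sgn • fluxV G M C A U x.elem x.dir x.node

/-- The interior penalty matrix `∑ n_m c_{m,j}(u) n_j` applied to the vector `δ`. -/
def viscNormal (u : V5) (n : V3) (δ : V5) : V5 :=
  ∑ m, n m • G.viscFlux u (fun j => n j • δ) m

/-! ### Penalties and right-hand side -/

/-- Inviscid and viscous interface penalties at the face point `x` matched with `y`. -/
def penInterface (x y : FaceNode K p) : V5 :=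
  let u := atFace U x
  let v := atFace U y
  let n := M.normal x
  let δ := G.entropyVar v - G.entropyVar u
  ((∑ m, n m • G.invFlux u m) - fluxMR G f u v n)
    - ((1 + C.α x) / 2) • (fluxVn G M C A U x + fluxVn G M C A U y)
    + (C.β x / 2) • ((M.J x.elem x.node)⁻¹ • viscNormal G u n δ
        + (M.J y.elem y.node)⁻¹ • viscNormal G v n δ)

/-- All penalties on the solution at a face point. -/
def penTotal (x : FaceNode K p) : V5 :=
  match M.nbr x with
  | some y => penInterface G M f C A U x y + penAD G M C A U x y
  | none => A.pen x

/-- Total flux at flux points: inviscid flux minus both artificial dissipation fluxes. -/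
def fluxTotal (k : Fin K) (l : Fin 3) (q : Node p) (i : Fin (p + 2)) : V5 :=
  (fluxEC G M f U k l q i - fluxED G M U k l q i) - fluxADσ G M A U k l q i
    - fluxAD G M C A U k l q i

/-- The value of `d(J U)/dt` prescribed by the semi-discrete scheme. -/
def rhs (k : Fin K) (q : Node p) : V5 :=
  ∑ l, (-((S.P (q l))⁻¹ •
        (fluxTotal G M f C A U k l q (q l).succ - fluxTotal G M f C A U k l q (q l).castSucc))
      + S.Dxi l (fluxV G M C A U k l) q
      + (S.P (q l))⁻¹ • onFaces (penTotal G M f C A U) k l q)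

/-- The discrete integral of the entropy. -/
def totalEntropy : ℝ := ∑ k, ∑ q, S.vol q * M.J k q * G.entropy (U k q)

/-- The net entropy supplied through the boundary of the domain: outflow of entropy, viscous
boundary flux and work of the boundary penalties. Boundary conditions are entropy stable
if it is not positive. -/
def boundaryEntropy : ℝ :=
  ∑ x : FaceNode K p, if M.nbr x = none then
    x.weight S * (-(∑ m, M.normal x m * G.entropyFlux (atFace U x) m)
      + G.entropyVar (atFace U x) ⬝ᵥ (fluxVn G M C A U x + A.pen x)
      + A.gradPen x ⬝ᵥ fluxVn G M C A U x) else 0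

end Scheme

/-- `U` solves the semi-discrete scheme on the time interval `I`. -/
def IsSolution (G : Gas) {p K : ℕ} {S : SBP p} (M : Mesh S K) (f : TwoPointFlux G)
    (C : Params M) (A : ℝ → Fields K p) (I : Set ℝ) (U : ℝ → State K p) : Prop :=
  ∀ t ∈ I, ∀ k q,
    HasDerivWithinAt (fun τ => M.J k q • U τ k q) (rhs G M f C (A t) (U t) k q) I t

end NSScheme

end

open NSScheme

noncomputable section

namespace NSScheme

/-! Contract the scheme with the entropy variables `w` and the volume weights. Since `w` is the
gradient of the entropy and `J` is static, this produces the time derivative of the total entropy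
(`hasDerivWithinAt_totalEntropy`), and the contracted right-hand side has to be shown nonpositive.

On one grid line, Abel summation turns the inviscid part into end values plus jumps of `w` paired
with the interior fluxes. The entropy conservative flux converts each jump into a jump of the
potential `ψ`; the Roe and Brenner fluxes can only lower the sum. Integration by parts for the
averaged metric (`sum_flux_point_metric`) replaces the potential jumps by end values, which cancel
the `ψ` in `w · f = ψ + F`, and by a remainder `-∑ ψ Q a`. The viscous part is integrated by parts
with `Q`, and the gradient penalty moves to the faces. The outcome is `sum_line_production_le`.

Two terms are controlled only after adding the three directions at a fixed point: the metric
remainder vanishes by the geometric conservation law (`sum_metric_eq_zero`), and the viscous term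
becomes the nonnegative Navier–Stokes dissipation (`sum_gradξ_dotProduct_fluxV_nonneg`). What
survives lives on faces. At a matched pair the viscous fluxes cancel exactly and every other
contribution is dissipative (`faceEntropy_add_nonpos`); at the domain boundary the sum is the
assumed nonpositive one. -/

theorem dotProduct_V5 (u v : V5) :
    u ⬝ᵥ v = u 0 * v 0 + (∑ i, u (mid i) * v (mid i)) + u 4 * v 4 := by
  simp only [dotProduct, Fin.sum_univ_five, Fin.sum_univ_three, add_assoc]
  rfl

@[simp] theorem vec5_zero (a : ℝ) (v : V3) (b : ℝ) : vec5 a v b 0 = a := rfl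

@[simp] theorem vec5_mid (a : ℝ) (v : V3) (b : ℝ) (i : Fin 3) : vec5 a v b (mid i) = v i := by
  fin_cases i <;> rfl

@[simp] theorem vec5_four (a : ℝ) (v : V3) (b : ℝ) : vec5 a v b 4 = b := rfl

/-! ### Behaviour of normals and means when the two sides are exchanged -/

theorem len_neg (n : V3) : len (-n) = len n := by simp [len]

theorem unit_neg (n : V3) : unit (-n) = -unit n := by simp [unit, len_neg]

theorem harmMean_comm (x y : ℝ) : harmMean x y = harmMean y x := by
  unfold harmMean; rw [add_comm x y]; ring

theorem geomMean_comm (x y : ℝ) : geomMean x y = geomMean y x := by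
  unfold geomMean; rw [mul_comm]

namespace Gas

variable (G : Gas)

theorem cv_pos : 0 < G.cv := div_pos G.R_pos (sub_pos.mpr G.one_lt_γ)

theorem cP_eq : G.cP = G.cv + G.R := by
  have := (sub_pos.mpr G.one_lt_γ).ne'
  unfold cP cv; field_simp; ring

/-! ### The entropy variables are the gradient of the entropy -/

theorem hasDerivWithinAt_entropy {u : ℝ → V5} {u' : V5} {I : Set ℝ} {t : ℝ}
    (hu : HasDerivWithinAt u u' I t) (h : G.Admissible (u t)) :
    HasDerivWithinAt (fun τ => G.entropy (u τ)) (G.entropyVar (u t) ⬝ᵥ u') I t := by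
  have hc := hasDerivWithinAt_pi.mp hu
  have hcv := G.cv_pos.ne'
  have h0 := h.1.ne'
  have hT := h.2.ne'
  have hV : ∀ i : Fin 3, HasDerivWithinAt (fun τ => vel (u τ) i)
      ((u' (mid i) - vel (u t) i * u' 0) / u t 0) I t := by
    intro i
    refine ((hc (mid i)).div (hc 0) h0).congr_deriv ?_
    unfold vel; field_simp
  have hVV : HasDerivWithinAt (fun τ => vel (u τ) ⬝ᵥ vel (u τ))
      (∑ i, 2 * vel (u t) i * ((u' (mid i) - vel (u t) i * u' 0) / u t 0)) I t := by
    unfold dotProduct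
    refine HasDerivWithinAt.fun_sum fun i _ => ?_
    exact ((hV i).mul (hV i)).congr_deriv (by ring)
  have hTd : HasDerivWithinAt (fun τ => G.temp (u τ))
      (((u' 4 * u t 0 - u t 4 * u' 0) / u t 0 ^ 2 -
        (∑ i, 2 * vel (u t) i * ((u' (mid i) - vel (u t) i * u' 0) / u t 0)) / 2) / G.cv) I t :=
    (((hc 4).div (hc 0) h0).sub (hVV.div_const 2)).div_const _
  have hS := (hc 0).neg.mul ((((hTd.log hT).const_mul G.cv).sub
    (((hc 0).log h0).const_mul G.R)).add_const G.s₀)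
  refine hS.congr_deriv (Eq.symm ?_)
  -- Eliminating the total energy and folding the logarithms back into `s` leaves a rational
  -- identity in density, velocity, temperature and `s`.
  have he : u t 4 = u t 0 * (G.cv * G.temp (u t) + (vel (u t) ⬝ᵥ vel (u t)) / 2) := by
    unfold temp; field_simp; ring
  rw [dotProduct_V5, he]
  simp only [entropyVar, vec5_zero, vec5_mid, vec5_four, G.cP_eq, Pi.smul_apply, smul_eq_mul,
    Fin.sum_univ_three, dotProduct]
  have hs : G.thermoEntropy (u t) =
    G.cv * Real.log (G.temp (u t)) - G.R * Real.log (u t 0) + G.s₀ := rfl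
  simp only [Pi.sub_apply, Pi.neg_apply]
  rw [← hs]
  field_simp
  ring

/-! ### Dissipation by the physical viscous fluxes -/

/-- The work term `τ V` of the energy flux completes the momentum part to the velocity gradient, so
the form equals `(τ : ∇V) / T + κ T² |Θ₅|²`, with `Θ₅` the gradient of the last entropy variable. -/
theorem sum_dotProduct_viscFlux_nonneg {u : V5} (hu : G.Admissible u) (Θ : Fin 3 → V5) :
    0 ≤ ∑ m, Θ m ⬝ᵥ G.viscFlux u Θ m := by
  have hT := hu.2
  have hμ := G.μ_nonneg _ hT
  have hκ := G.κ_nonneg _ hT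
  have key : ∑ m, Θ m ⬝ᵥ G.viscFlux u Θ m =
      (G.temp u)⁻¹ * ∑ m, ∑ i, G.stress u Θ i m * G.gradV u Θ i m
        + G.κ (G.temp u) * G.temp u ^ 2 * ∑ m, Θ m 4 ^ 2 := by
    rw [Finset.mul_sum, Finset.mul_sum, ← Finset.sum_add_distrib]
    refine Finset.sum_congr rfl fun m _ => ?_
    rw [dotProduct_V5]
    simp only [viscFlux, vec5_zero, vec5_mid, vec5_four, gradV, gradT, Fin.sum_univ_three]
    field_simp
    ring
  rw [key]
  have h2 : 0 ≤ ∑ m, ∑ i, G.stress u Θ i m * G.gradV u Θ i m := by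
    unfold stress
    generalize G.gradV u Θ = g
    -- The factor `2/3` makes the stress trace-free, which is what turns the diagonal part into
    -- squared differences.
    have : ∑ m, ∑ i, G.μ (G.temp u) * (g i m + g m i - if i = m then 2 / 3 * ∑ n, g n n else 0)
        * g i m = G.μ (G.temp u) * ((g 0 1 + g 1 0) ^ 2 + (g 0 2 + g 2 0) ^ 2
          + (g 1 2 + g 2 1) ^ 2 + 2 / 3 * ((g 0 0 - g 1 1) ^ 2 + (g 0 0 - g 2 2) ^ 2
          + (g 1 1 - g 2 2) ^ 2)) := by
      simp [Fin.sum_univ_three]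
      ring
    rw [this]
    positivity
  positivity

theorem dotProduct_viscNormal_nonneg {u : V5} (hu : G.Admissible u) (n : V3) (δ : V5) :
    0 ≤ δ ⬝ᵥ viscNormal G u n δ := by
  convert G.sum_dotProduct_viscFlux_nonneg hu (fun j => n j • δ) using 1
  simp [viscNormal, dotProduct_sum, dotProduct_smul, smul_dotProduct]

theorem viscNormal_neg_neg (u : V5) (n : V3) (δ : V5) :
    viscNormal G u (-n) (-δ) = -viscNormal G u n δ := by
  simp [viscNormal]

/-! ### Dissipation by the Brenner-type fluxes -/

/-- The normal enters only through `‖n‖²` and products of two components of the unit normal, and all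
averages are symmetric. Hence the two sides of an interface use the same matrix. -/
theorem brenner_comm (u₁ u₂ : V5) (n : V3) (σ μ κ : ℝ) :
    G.brenner u₂ u₁ (-n) σ μ κ = G.brenner u₁ u₂ n σ μ κ := by
  have hE : G.Eavg u₂ u₁ = G.Eavg u₁ u₂ := by
    unfold Eavg
    rw [geomMean_comm, logMean_comm, dotProduct_comm]
  unfold brenner
  simp only [hE, unit_neg, len_neg, add_comm (vel u₂), Pi.neg_apply, dotProduct_neg,
    neg_mul, mul_neg, neg_neg, neg_div]

/-- The averages are chosen to remove all cross terms. In the mass column, `T_G² / T_L` cancels the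
jump of `c_v log T`, while `V_A` and `V₁ · V₂ / 2` cancel the jump of `|V|² / (2T)`. In the momentum
columns, `V_A` leaves the jump of `V` times the arithmetic mean of `1/T`. -/
theorem entropyVar_sub_dotProduct_brenner {u₁ u₂ : V5} (h₁ : G.Admissible u₁)
    (h₂ : G.Admissible u₂) (n : V3) (σ μ κ : ℝ) :
    (G.entropyVar u₂ - G.entropyVar u₁) ⬝ᵥ
      (G.brenner u₁ u₂ n σ μ κ *ᵥ (G.prim u₂ - G.prim u₁)) =
    len n ^ 2 * (σ * G.R * (Real.log (u₂ 0) - Real.log (u₁ 0)) * (u₂ 0 - u₁ 0)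
      + μ * ((G.temp u₁)⁻¹ + (G.temp u₂)⁻¹) / 2 *
        ((∑ i, (vel u₂ i - vel u₁ i) ^ 2)
          + (∑ i, unit n i * (vel u₂ i - vel u₁ i)) ^ 2 / 3)
      + κ * (G.temp u₂ - G.temp u₁) ^ 2 / (G.temp u₁ * G.temp u₂)) := by
  have hT₁ := h₁.2
  have hT₂ := h₂.2
  have hL := logMean_mul hT₁ hT₂
  have hLp := logMean_pos hT₁ hT₂
  have hgm : geomMean (G.temp u₁) (G.temp u₂) ^ 2 = G.temp u₁ * G.temp u₂ :=
    Real.sq_sqrt (by positivity)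
  -- The logarithmic mean expresses one logarithm of temperature through the other, after which the
  -- identity is rational.
  have hlog : Real.log (G.temp u₁) = Real.log (G.temp u₂)
      + (G.temp u₁ - G.temp u₂) / logMean (G.temp u₁) (G.temp u₂) := by
    field_simp; linarith
  unfold brenner Eavg entropyVar prim thermoEntropy
  rw [hgm, hlog]
  have hcv : G.R / (G.γ - 1) = G.cv := rfl
  rw [hcv]
  generalize logMean (G.temp u₁) (G.temp u₂) = TL at *
  generalize Real.log (G.temp u₂) = l
  generalize Real.log (u₁ 0) = l₁
  generalize Real.log (u₂ 0) = l₂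
  generalize G.temp u₁ = T₁ at *
  generalize G.temp u₂ = T₂ at *
  generalize vel u₁ = V₁
  generalize vel u₂ = V₂
  generalize unit n = e
  generalize len n = d
  simp [dotProduct, mulVec, vec5, Fin.sum_univ_succ]
  field_simp
  ring

theorem dotProduct_brenner_nonneg {u₁ u₂ : V5} (h₁ : G.Admissible u₁) (h₂ : G.Admissible u₂)
    (n : V3) {σ μ κ : ℝ} (hσ : 0 ≤ σ) (hμ : 0 ≤ μ) (hκ : 0 ≤ κ) :
    0 ≤ (G.entropyVar u₂ - G.entropyVar u₁) ⬝ᵥ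
      (G.brenner u₁ u₂ n σ μ κ *ᵥ (G.prim u₂ - G.prim u₁)) := by
  rw [G.entropyVar_sub_dotProduct_brenner h₁ h₂]
  have hT₁ := h₁.2
  have hT₂ := h₂.2
  have hR := G.R_pos
  have hlog : 0 ≤ (Real.log (u₂ 0) - Real.log (u₁ 0)) * (u₂ 0 - u₁ 0) := by
    rcases le_total (u₁ 0) (u₂ 0) with h | h
    · exact mul_nonneg (sub_nonneg.mpr (Real.log_le_log h₁.1 h)) (sub_nonneg.mpr h)
    · exact mul_nonneg_of_nonpos_of_nonpos (sub_nonpos.mpr (Real.log_le_log h₂.1 h))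
        (sub_nonpos.mpr h)
  have : 0 ≤ σ * G.R * (Real.log (u₂ 0) - Real.log (u₁ 0)) * (u₂ 0 - u₁ 0) := by
    rw [mul_assoc]; positivity
  positivity

/-! ### Dissipation by the Merriam–Roe fluxes -/

/-- The form is `½ ∑ |λ_i| (𝒴ᵀ δ)_i²`; no property of the eigenvectors enters. -/
theorem roeMatrix_nonneg (u₁ u₂ : V5) (n : V3) (δ : V5) :
    0 ≤ δ ⬝ᵥ (G.roeMatrix u₁ u₂ n *ᵥ δ) := by
  unfold roeMatrix
  simp only [smul_mulVec, dotProduct_smul, ← mulVec_mulVec, smul_eq_mul]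
  refine mul_nonneg (by norm_num) ?_
  rw [dotProduct_mulVec, ← mulVec_transpose]
  generalize (G.eigY _ _ _ n)ᵀ *ᵥ δ = z
  simp only [dotProduct, mulVec_diagonal]
  refine Finset.sum_nonneg fun i _ => ?_
  rw [mul_left_comm, ← sq]
  positivity

/-- Reversing the normal swaps the two acoustic columns together with the absolute values of their
eigenvalues, and changes the sign of the other three columns. The sum `∑ |λ_i| y_i y_iᵀ` does not
notice. -/
theorem eigY_abs_eigVal_neg (ρ : ℝ) (V : V3) (T : ℝ) (n : V3) :
    G.eigY ρ V T (-n) * diagonal (fun i => |G.eigVal V T (-n) i|) * (G.eigY ρ V T (-n))ᵀ =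
      G.eigY ρ V T n * diagonal (fun i => |G.eigVal V T n i|) * (G.eigY ρ V T n)ᵀ := by
  have h1 : |-(V ⬝ᵥ n) - √(G.γ * G.R * T) * len n| = |V ⬝ᵥ n + √(G.γ * G.R * T) * len n| := by
    rw [← abs_neg]; ring_nf
  have h2 : |-(V ⬝ᵥ n) + √(G.γ * G.R * T) * len n| = |V ⬝ᵥ n - √(G.γ * G.R * T) * len n| := by
    rw [← abs_neg]; ring_nf
  have key (Y : Matrix (Fin 5) (Fin 5) ℝ) (d : V5) (i j : Fin 5) :
      (Y * diagonal d * Yᵀ) i j = Y i 0 * d 0 * Y j 0 + Y i 1 * d 1 * Y j 1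
        + Y i 2 * d 2 * Y j 2 + Y i 3 * d 3 * Y j 3 + Y i 4 * d 4 * Y j 4 := by
    rw [mul_apply, Fin.sum_univ_five]
    simp only [mul_diagonal, transpose_apply]
  have hv : ∀ (v : V3) (b : ℝ) (i : Fin 5), vec5 0 (-v) (-b) i = -vec5 0 v b i := by
    intro v b i; fin_cases i <;> simp [vec5]
  ext i j
  simp only [key, transpose_apply, eigY, eigVal, of_apply,
    unit_neg, len_neg, dotProduct_neg, map_neg, LinearMap.neg_apply, Pi.neg_apply, smul_neg,
    neg_mul, one_mul, neg_smul, neg_neg]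
  simp only [Matrix.cons_val, Pi.smul_apply, Pi.add_apply, smul_eq_mul, h1, h2, abs_neg, mul_neg,
    neg_neg, neg_mul, hv]
  ring

theorem roeMatrix_comm (u₁ u₂ : V5) (n : V3) :
    G.roeMatrix u₂ u₁ (-n) = G.roeMatrix u₁ u₂ n := by
  unfold roeMatrix
  simp only [eigY_abs_eigVal_neg, logMean_comm (u₂ 0), harmMean_comm (G.temp u₂),
    add_comm (G.temp u₂), add_comm (G.temp u₁ • vel u₂)]

end Gas

/-! ### Summation along grid lines -/

theorem sum_node_eq_sum_lines {p : ℕ} (l : Fin 3) (h : Node p → ℝ) :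
    ∑ q, h q = ∑ r : Fin 2 → Fin (p + 1), ∑ i, h (l.insertNth i r) := by
  rw [← (Fin.insertNthEquiv (fun _ => Fin (p + 1)) l).sum_comp, Fintype.sum_prod_type_right]
  rfl

theorem sum_node_le_of_lines {p : ℕ} (l : Fin 3) {h₁ h₂ : Node p → ℝ}
    (H : ∀ q, ∑ i, h₁ (Function.update q l i) ≤ ∑ i, h₂ (Function.update q l i)) :
    ∑ q, h₁ q ≤ ∑ q, h₂ q := by
  rw [sum_node_eq_sum_lines l, sum_node_eq_sum_lines l]
  refine Finset.sum_le_sum fun r _ => ?_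
  -- Each line is represented once, by its point with `l`-th coordinate `0`; the update overwrites
  -- that coordinate.
  simpa [Fin.update_insertNth] using H (l.insertNth 0 r)

/-- Abel summation: there is one more flux point than solution points, and the interior ones are
`j.succ.castSucc`. -/
theorem sum_dotProduct_sub {p n : ℕ} (w : Fin (p + 1) → Fin n → ℝ) (F : Fin (p + 2) → Fin n → ℝ) :
    ∑ i, w i ⬝ᵥ (F i.succ - F i.castSucc) =
      w (Fin.last p) ⬝ᵥ F (Fin.last (p + 1)) - w 0 ⬝ᵥ F 0
        - ∑ j : Fin p, (w j.succ - w j.castSucc) ⬝ᵥ F j.succ.castSucc := by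
  simp only [dotProduct_sub, sub_dotProduct, Finset.sum_sub_distrib]
  rw [Fin.sum_univ_castSucc (fun i => w i ⬝ᵥ F i.succ),
    Fin.sum_univ_succ (fun i => w i ⬝ᵥ F i.castSucc)]
  simp only [Fin.succ_castSucc, Fin.succ_last, Fin.castSucc_zero]
  ring

/-- Telescoping, with the range written as an indicator so that sums over flux points and over pairs
of solution points can be interchanged. -/
theorem sum_ite_sub {p : ℕ} (ψ : Fin (p + 1) → ℝ) (s r : Fin (p + 1)) :
    (∑ j : Fin p, if s ≤ j.castSucc ∧ j.castSucc < r then ψ j.succ - ψ j.castSucc else 0) =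
      if s ≤ r then ψ r - ψ s else 0 := by
  induction r using Fin.induction with
  | zero =>
    rcases eq_or_ne s 0 with h | h <;> simp [h]
  | succ k ih =>
    have hsplit : ∀ j : Fin p,
        (if s ≤ j.castSucc ∧ j.castSucc < k.succ then ψ j.succ - ψ j.castSucc else 0) =
        (if s ≤ j.castSucc ∧ j.castSucc < k.castSucc then ψ j.succ - ψ j.castSucc else 0)
        + if j = k then (if s ≤ k.castSucc then ψ k.succ - ψ k.castSucc else 0) else 0 := by
      intro j
      rcases eq_or_ne j k with rfl | h
      · simp
      · have : j.castSucc < k.succ ↔ j.castSucc < k.castSucc := by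
          simp only [Fin.lt_def, Fin.val_castSucc, Fin.val_succ]
          have := Fin.val_ne_of_ne h
          omega
        simp [h, this]
    rw [Finset.sum_congr rfl fun j _ => hsplit j, Finset.sum_add_distrib, ih]
    simp only [Finset.sum_ite_eq', Finset.mem_univ, if_true]
    by_cases h : s ≤ k.castSucc
    · rw [if_pos h, if_pos h, if_pos (h.trans (Fin.castSucc_lt_succ).le)]
      ring
    · rw [if_neg h, if_neg h]
      by_cases h' : s ≤ k.succ
      · have : s = k.succ := by
          simp only [Fin.le_def, Fin.val_castSucc, Fin.val_succ, Fin.ext_iff] at *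
          omega
        simp [this]
      · simp [h']

/-! ### One-dimensional summation by parts -/

namespace SBP

variable {p : ℕ} (S : SBP p)

theorem Q_add (i j : Fin (p + 1)) : S.Q i j + S.Q j i =
    if i = j then (if i = Fin.last p then 1 else 0) - (if i = 0 then 1 else 0) else 0 := by
  simpa [diagonal_apply] using congrFun (congrFun S.Q_add_transpose i) j

theorem sum_Q_by_parts (x y : Fin (p + 1) → ℝ) :
    ∑ i, x i * ∑ n, S.Q i n * y n =
      x (Fin.last p) * y (Fin.last p) - x 0 * y 0 - ∑ i, (∑ n, S.Q i n * x n) * y i := by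
  rw [eq_sub_iff_add_eq]
  have h2 : ∑ i, (∑ n, S.Q i n * x n) * y i = ∑ i, ∑ n, S.Q n i * x i * y n := by
    rw [Finset.sum_comm]
    exact Finset.sum_congr rfl fun i _ => Finset.sum_mul ..
  rw [h2, ← Finset.sum_add_distrib]
  have h3 : ∀ i, (x i * ∑ n, S.Q i n * y n) + ∑ n, S.Q n i * x i * y n =
      ((if i = Fin.last p then 1 else 0) - (if i = 0 then 1 else 0)) * (x i * y i) := by
    intro i
    rw [Finset.mul_sum, ← Finset.sum_add_distrib]
    have : ∀ n, x i * (S.Q i n * y n) + S.Q n i * x i * y n =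
        if i = n then ((if i = Fin.last p then 1 else 0) - (if i = 0 then 1 else 0))
          * (x i * y n) else 0 := by
      intro n
      have := S.Q_add i n
      rw [← ite_zero_mul, ← this]
      ring
    simp [this]
  simp [h3, sub_mul]

theorem sum_dotProduct_Q_by_parts {n : ℕ} (x y : Fin (p + 1) → Fin n → ℝ) :
    ∑ i, x i ⬝ᵥ ∑ j, S.Q i j • y j =
      x (Fin.last p) ⬝ᵥ y (Fin.last p) - x 0 ⬝ᵥ y 0 - ∑ i, (∑ j, S.Q i j • x j) ⬝ᵥ y i := by
  simp only [dotProduct, Finset.sum_apply, Pi.smul_apply, smul_eq_mul]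
  rw [Finset.sum_comm (f := fun i c => x i c * _), Finset.sum_comm (f := fun i c => _ * y i c),
    ← Finset.sum_sub_distrib, ← Finset.sum_sub_distrib]
  exact Finset.sum_congr rfl fun c _ => S.sum_Q_by_parts (fun i => x i c) (fun i => y i c)

/-- Summation by parts for metric coefficients averaged to the flux points. -/
theorem sum_flux_point_metric (a ψ : Fin (p + 1) → ℝ) :
    ∑ j : Fin p, (∑ r ∈ Finset.Ioi j.castSucc, ∑ s ∈ Finset.Iic j.castSucc,
        2 * S.Q s r * (1 / 2 * (a s + a r))) * (ψ j.succ - ψ j.castSucc) =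
      ψ (Fin.last p) * a (Fin.last p) - ψ 0 * a 0 - ∑ i, ψ i * ∑ n, S.Q i n * a n := by
  have h1 : ∀ j : Fin p, (∑ r ∈ Finset.Ioi j.castSucc, ∑ s ∈ Finset.Iic j.castSucc,
        2 * S.Q s r * (1 / 2 * (a s + a r))) * (ψ j.succ - ψ j.castSucc) =
      ∑ r, ∑ s, S.Q s r * (a s + a r) *
        if s ≤ j.castSucc ∧ j.castSucc < r then ψ j.succ - ψ j.castSucc else 0 := by
    intro j
    rw [← Finset.filter_lt_eq_Ioi, ← Finset.filter_ge_eq_Iic, Finset.sum_filter, Finset.sum_mul]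
    refine Finset.sum_congr rfl fun r _ => ?_
    by_cases hr : j.castSucc < r
    · simp only [hr, if_true, and_true]
      rw [Finset.sum_filter, Finset.sum_mul]
      refine Finset.sum_congr rfl fun s _ => ?_
      split_ifs <;> ring
    · simp [hr]
  rw [Finset.sum_congr rfl fun j _ => h1 j, Finset.sum_comm]
  have h2 : ∀ r, (∑ j : Fin p, ∑ s, S.Q s r * (a s + a r) *
        if s ≤ j.castSucc ∧ j.castSucc < r then ψ j.succ - ψ j.castSucc else 0) =
      ∑ s, S.Q s r * (a s + a r) * if s ≤ r then ψ r - ψ s else 0 := by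
    intro r
    rw [Finset.sum_comm]
    refine Finset.sum_congr rfl fun s _ => ?_
    rw [← Finset.mul_sum, sum_ite_sub]
  rw [Finset.sum_congr rfl fun r _ => h2 r]
  -- Off the diagonal `Q` is antisymmetric, as is `ψ r - ψ s`, so both triangles contribute equally;
  -- the diagonal contributes nothing. The half sum is therefore half of the full double sum.
  have h3 : (∑ r, ∑ s, S.Q s r * (a s + a r) * if s ≤ r then ψ r - ψ s else 0) =
      ∑ r, ∑ s, S.Q s r * (a s + a r) * if r ≤ s then ψ r - ψ s else 0 := by
    rw [Finset.sum_comm]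
    refine Finset.sum_congr rfl fun r _ => Finset.sum_congr rfl fun s _ => ?_
    rcases eq_or_ne r s with rfl | h
    · simp
    · have hQ := S.Q_add r s
      rw [if_neg h] at hQ
      rw [eq_neg_of_add_eq_zero_left hQ]
      split_ifs <;> ring
  have h4 : (∑ r, ∑ s, S.Q s r * (a s + a r) * if s ≤ r then ψ r - ψ s else 0)
      + (∑ r, ∑ s, S.Q s r * (a s + a r) * if r ≤ s then ψ r - ψ s else 0) =
      ∑ s, ∑ r, S.Q s r * (a s + a r) * (ψ r - ψ s) := by
    rw [← Finset.sum_add_distrib, Finset.sum_comm]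
    refine Finset.sum_congr rfl fun r _ => ?_
    rw [← Finset.sum_add_distrib]
    refine Finset.sum_congr rfl fun s _ => ?_
    rcases lt_trichotomy s r with h | rfl | h
    · rw [if_pos h.le, if_neg h.not_ge]; ring
    · simp
    · rw [if_pos h.le, if_neg h.not_ge]; ring
  -- Expanding the product gives `a·Qψ + 1·Q(aψ) - aψ·Q1 - ψ·Qa`. Summation by parts in the first
  -- two terms, together with `Q 1 = 0`, yields twice the claimed right-hand side.
  have h5 : ∑ s, ∑ r, S.Q s r * (a s + a r) * (ψ r - ψ s) =
      (∑ s, a s * ∑ r, S.Q s r * ψ r) + (∑ s, 1 * ∑ r, S.Q s r * (a r * ψ r))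
        - (∑ s, a s * ψ s * ∑ r, S.Q s r) - ∑ s, ψ s * ∑ r, S.Q s r * a r := by
    simp only [Finset.mul_sum, ← Finset.sum_add_distrib, ← Finset.sum_sub_distrib]
    refine Finset.sum_congr rfl fun s _ => Finset.sum_congr rfl fun r _ => ?_
    ring
  rw [S.sum_Q_by_parts a, S.sum_Q_by_parts (fun _ => 1)] at h5
  simp only [mul_one, S.Q_one, mul_zero, zero_mul, Finset.sum_const_zero] at h5
  have h6 : ∑ i, (∑ n, S.Q i n * a n) * ψ i = ∑ s, ψ s * ∑ r, S.Q s r * a r :=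
    Finset.sum_congr rfl fun i _ => mul_comm _ _
  linarith

/-- The product of the weights of a solution point in the directions other than `l`. -/
def perp (l : Fin 3) (q : Node p) : ℝ := ∏ l' ∈ Finset.univ.erase l, S.P (q l')

theorem perp_pos (l : Fin 3) (q : Node p) : 0 < S.perp l q :=
  Finset.prod_pos fun _ _ => S.P_pos _

theorem perp_update (l : Fin 3) (q : Node p) (i : Fin (p + 1)) :
    S.perp l (Function.update q l i) = S.perp l q :=
  Finset.prod_congr rfl fun _ h => by rw [Function.update_of_ne (Finset.ne_of_mem_erase h)]

theorem vol_eq (l : Fin 3) (q : Node p) : S.vol q = S.perp l q * S.P (q l) :=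
  (Finset.prod_erase_mul _ _ (Finset.mem_univ l)).symm

theorem vol_pos (q : Node p) : 0 < S.vol q := Finset.prod_pos fun _ _ => S.P_pos _

theorem P_smul_Dxi (l : Fin 3) (g : Node p → V5) (q : Node p) :
    S.P (q l) • S.Dxi l g q = ∑ n, S.Q (q l) n • g (Function.update q l n) := by
  unfold Dxi D
  rw [Finset.smul_sum]
  refine Finset.sum_congr rfl fun n _ => ?_
  rw [smul_smul, mul_inv_cancel_left₀ (S.P_pos _).ne']

/-- Matched points may sit at different ends of their grid lines; the symmetry of `P` gives their
penalties the same scaling. -/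
theorem P_endIdx (s t : Bool) : S.P (endIdx p s) = S.P (endIdx p t) := by
  have : S.P (Fin.last p) = S.P 0 := by simpa using S.P_rev 0
  cases s <;> cases t <;> simp [endIdx, this]

end SBP

/-! ### Summation over element faces -/

/-- The sum of `τ` over the two faces normal to direction `l` on which a solution point lies. -/
def faceSum {K p : ℕ} (τ : FaceNode K p → ℝ) (k : Fin K) (l : Fin 3) (q : Node p) : ℝ :=
  ∑ s : Bool, if h : q l = endIdx p s then τ ⟨(k, l, s, q), h⟩ else 0

theorem sum_faceSum_line {K p : ℕ} (τ : FaceNode K p → ℝ) (k : Fin K) (l : Fin 3) (q : Node p) :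
    ∑ i, faceSum τ k l (Function.update q l i) =
      τ ⟨(k, l, true, Function.update q l (Fin.last p)), Function.update_self ..⟩
        + τ ⟨(k, l, false, Function.update q l 0), Function.update_self ..⟩ := by
  unfold faceSum
  rw [Finset.sum_comm, Fintype.sum_bool]
  congr 1
  · rw [Finset.sum_eq_single (Fin.last p)]
    · rw [dif_pos (by simp [endIdx])]
    · intro i _ h
      rw [dif_neg (by simpa [endIdx] using h)]
    · simp
  · rw [Finset.sum_eq_single 0]
    · rw [dif_pos (by simp [endIdx])]
    · intro i _ h
      rw [dif_neg (by simpa [endIdx] using h)]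
    · simp

/-- Pure reindexing: `perp` is the surface weight, and the subtype of face points is summed as all
indices with an indicator. -/
theorem sum_perp_mul_faceSum {K p : ℕ} (S : SBP p) (τ : FaceNode K p → ℝ) :
    ∑ k, ∑ l, ∑ q, S.perp l q * faceSum τ k l q = ∑ x : FaceNode K p, x.weight S * τ x := by
  have h : ∀ g : FaceNode K p → ℝ, ∑ x, g x = ∑ y : Fin K × Fin 3 × Bool × Node p,
      if h : y.2.2.2 y.2.1 = endIdx p y.2.2.1 then g ⟨y, h⟩ else 0 := by
    intro g
    rw [← Fintype.sum_subtype_add_sum_subtype (fun y : Fin K × Fin 3 × Bool × Node p =>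
      y.2.2.2 y.2.1 = endIdx p y.2.2.1), Finset.sum_eq_zero (s := Finset.univ (α := { x // ¬_ }))
      fun x _ => dif_neg x.2, add_zero]
    exact Finset.sum_congr rfl fun x _ => by rw [dif_pos x.2]
  rw [h]
  simp only [Fintype.sum_prod_type, faceSum, Finset.mul_sum]
  refine Finset.sum_congr rfl fun k _ => Finset.sum_congr rfl fun l _ => ?_
  rw [Finset.sum_comm]
  refine Finset.sum_congr rfl fun s _ => Finset.sum_congr rfl fun q _ => ?_
  split_ifs
  · rfl
  · simp

theorem dotProduct_onFaces {K p : ℕ} (w : Fin K → Node p → V5) (g : FaceNode K p → V5)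
    (k : Fin K) (l : Fin 3) (q : Node p) :
    w k q ⬝ᵥ onFaces g k l q = faceSum (fun x => w x.elem x.node ⬝ᵥ g x) k l q := by
  unfold onFaces faceSum
  rw [dotProduct_sum]
  refine Finset.sum_congr rfl fun s _ => ?_
  split_ifs
  · rfl
  · simp

section

variable {G : Gas} {p K : ℕ} {S : SBP p} {M : Mesh S K} {f : TwoPointFlux G} {C : Params M}
  {A : Fields K p} {U : State K p}

/-! ### Fluxes at the flux points of a grid line -/

theorem lineFlux_update (l : Fin 3) (inner : Node p → Node p → V5) (outer : Node p → V5)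
    (q : Node p) (i : Fin (p + 1)) :
    lineFlux l inner outer (Function.update q l i) = lineFlux l inner outer q := by
  funext j
  simp [lineFlux]

theorem lineFlux_zero (l : Fin 3) (inner : Node p → Node p → V5) (outer : Node p → V5)
    (q : Node p) : lineFlux l inner outer q 0 = outer (Function.update q l 0) := by
  simp [lineFlux]

theorem lineFlux_last (l : Fin 3) (inner : Node p → Node p → V5) (outer : Node p → V5)
    (q : Node p) :
    lineFlux l inner outer q (Fin.last (p + 1)) = outer (Function.update q l (Fin.last p)) := by
  simp [lineFlux]

theorem lineFlux_inner (l : Fin 3) (inner : Node p → Node p → V5) (outer : Node p → V5)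
    (q : Node p) (j : Fin p) : lineFlux l inner outer q j.succ.castSucc =
      inner (Function.update q l j.castSucc) (Function.update q l j.succ) := by
  unfold lineFlux
  rw [dif_pos (by simp)]
  rfl

theorem fluxTotal_update (k : Fin K) (l : Fin 3) (q : Node p) (i : Fin (p + 1)) :
    fluxTotal G M f C A U k l (Function.update q l i) = fluxTotal G M f C A U k l q := by
  funext j
  simp only [fluxTotal, fluxEC, fluxED, fluxAD, fluxADσ, lineFlux_update]

theorem TwoPointFlux.along_self (f : TwoPointFlux G) {u : V5} (hu : G.Admissible u) (n : V3) :
    f.along u u n = ∑ m, n m • G.invFlux u m := by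
  simp only [TwoPointFlux.along, f.consistent u hu]

theorem dotProduct_sum_invFlux (u : V5) (n : V3) :
    G.entropyVar u ⬝ᵥ ∑ m, n m • G.invFlux u m =
      (∑ m, n m * G.potential u m) + ∑ m, n m * G.entropyFlux u m := by
  simp only [dotProduct_sum, dotProduct_smul, ← Finset.sum_add_distrib, Gas.potential, smul_eq_mul]
  exact Finset.sum_congr rfl fun m _ => by ring

theorem TwoPointFlux.sub_dotProduct_along (f : TwoPointFlux G) {u₁ u₂ : V5}
    (h₁ : G.Admissible u₁) (h₂ : G.Admissible u₂) (n : V3) :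
    (G.entropyVar u₂ - G.entropyVar u₁) ⬝ᵥ f.along u₁ u₂ n =
      ∑ m, n m * (G.potential u₂ m - G.potential u₁ m) := by
  simp only [TwoPointFlux.along, dotProduct_sum, dotProduct_smul, smul_eq_mul]
  refine Finset.sum_congr rfl fun m _ => ?_
  rw [f.symm u₁ u₂ h₁ h₂, f.conservative u₂ u₁ h₂ h₁]

theorem dotProduct_brenner_jumpPrim_nonneg {u₁ u₂ : V5} (h₁ : G.Admissible u₁)
    (h₂ : G.Admissible u₂) (n : V3) {σ μ κ d : ℝ} (hσ : 0 ≤ σ) (hμ : 0 ≤ μ) (hκ : 0 ≤ κ)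
    (hd : 0 ≤ d) (J₁ J₂ : ℝ) :
    0 ≤ (G.entropyVar u₂ - G.entropyVar u₁) ⬝ᵥ
      (d⁻¹ • (G.brenner u₁ u₂ n σ μ κ *ᵥ jumpPrim G u₁ u₂ J₁ J₂)) := by
  have := G.dotProduct_brenner_nonneg h₁ h₂ n hσ hμ hκ
  simp only [jumpPrim, mulVec_smul, dotProduct_smul, smul_eq_mul]
  positivity

/-- The artificial viscosity averaged to an interface or a flux point is nonnegative. -/
theorem avg_μAD_nonneg (k k' : Fin K) (q q' : Node p) : 0 ≤ (A.μAD k q + A.μAD k' q') / 2 := by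
  have := A.μAD_nonneg k q
  have := A.μAD_nonneg k' q'
  positivity

/-- The entropy conservative part gives equality; each of the three dissipative fluxes is subtracted
and pairs nonnegatively with the jump of `w`. -/
theorem dotProduct_fluxTotal_inner_le (hU : ∀ k q, G.Admissible (U k q)) (k : Fin K) (l : Fin 3)
    (q : Node p) (j : Fin p) :
    (G.entropyVar (U k (Function.update q l j.succ)) -
      G.entropyVar (U k (Function.update q l j.castSucc))) ⬝ᵥ
        fluxTotal G M f C A U k l q j.succ.castSucc ≤
      ∑ m, M.abar k l (Function.update q l j.castSucc) m *
        (G.potential (U k (Function.update q l j.succ)) m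
          - G.potential (U k (Function.update q l j.castSucc)) m) := by
  simp only [fluxTotal, fluxEC, fluxED, fluxAD, fluxADσ, lineFlux_inner, Function.update_self]
  set q₁ := Function.update q l j.castSucc
  set q₂ := Function.update q l j.succ
  have hd : 0 ≤ S.node j.succ - S.node j.castSucc :=
    sub_nonneg.mpr (S.node_strictMono.monotone Fin.castSucc_lt_succ.le)
  have hμ := avg_μAD_nonneg (A := A) k k q₁ q₂
  rw [dotProduct_sub, dotProduct_sub, dotProduct_sub, f.sub_dotProduct_along (hU k q₁) (hU k q₂)]
  have h1 := G.roeMatrix_nonneg (U k q₁) (U k q₂) (M.abar k l q₁)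
    (G.entropyVar (U k q₂) - G.entropyVar (U k q₁))
  have h2 := dotProduct_brenner_jumpPrim_nonneg (hU k q₁) (hU k q₂) (M.abar k l q₁)
    (mul_nonneg C.cρ_pos.le hμ) hμ (mul_nonneg C.cT_pos.le hμ) hd (M.J k q₁) (M.J k q₂)
  have h3 := dotProduct_brenner_jumpPrim_nonneg (hU k q₁) (hU k q₂) (M.abar k l q₁)
    (A.σbar_nonneg k l q₁) le_rfl le_rfl hd (M.J k q₁) (M.J k q₂)
  linarith

/-! ### Entropy balance on a grid line -/

theorem sum_abar_mul_sub (k : Fin K) (l : Fin 3) (q : Node p) (m : Fin 3) (ψ : Fin (p + 1) → ℝ) :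
    ∑ j : Fin p, M.abar k l (Function.update q l j.castSucc) m * (ψ j.succ - ψ j.castSucc) =
      ψ (Fin.last p) * M.a k l (Function.update q l (Fin.last p)) m
        - ψ 0 * M.a k l (Function.update q l 0) m
        - ∑ i, ψ i * ∑ n, S.Q i n * M.a k l (Function.update q l n) m := by
  rw [← S.sum_flux_point_metric (fun i => M.a k l (Function.update q l i) m)]
  simp only [Mesh.abar, Function.update_self, Function.update_idem, Finset.sum_apply,
    Pi.smul_apply, Pi.add_apply, smul_eq_mul]

/-- At the ends `w · f = ψ + F`. The `ψ` there cancels against the end values produced by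
`sum_abar_mul_sub`, leaving the entropy flux and the metric remainder. -/
theorem sum_line_inviscid_le (hU : ∀ k q, G.Admissible (U k q)) (k : Fin K) (l : Fin 3)
    (q : Node p) :
    -∑ i, G.entropyVar (U k (Function.update q l i)) ⬝ᵥ
        (fluxTotal G M f C A U k l q i.succ - fluxTotal G M f C A U k l q i.castSucc) ≤
      (-∑ i, ∑ m, G.potential (U k (Function.update q l i)) m *
        ∑ n, S.Q i n * M.a k l (Function.update q l n) m)
      + ∑ i, faceSum (fun x => -∑ m, M.normal x m * G.entropyFlux (atFace U x) m) k l
          (Function.update q l i) := by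
  rw [sum_dotProduct_sub (fun i => G.entropyVar (U k (Function.update q l i))), sum_faceSum_line]
  -- At the end flux points the dissipation is zero and consistency reduces the two-point flux to
  -- the inviscid one.
  have hF0 : fluxTotal G M f C A U k l q 0 = ∑ m, M.a k l (Function.update q l 0) m •
      G.invFlux (U k (Function.update q l 0)) m := by
    simp only [fluxTotal, fluxEC, fluxED, fluxAD, fluxADσ, lineFlux_zero, sub_zero]
    exact f.along_self (hU _ _) _
  have hFl : fluxTotal G M f C A U k l q (Fin.last (p + 1)) =
      ∑ m, M.a k l (Function.update q l (Fin.last p)) m •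
        G.invFlux (U k (Function.update q l (Fin.last p))) m := by
    simp only [fluxTotal, fluxEC, fluxED, fluxAD, fluxADσ, lineFlux_last, sub_zero]
    exact f.along_self (hU _ _) _
  rw [hF0, hFl, dotProduct_sum_invFlux, dotProduct_sum_invFlux]
  have hin := Finset.sum_le_sum fun j (_ : j ∈ Finset.univ) =>
    dotProduct_fluxTotal_inner_le (M := M) (f := f) (C := C) (A := A) hU k l q j
  rw [Finset.sum_comm (s := Finset.univ (α := Fin p))] at hin
  have hab : ∀ m : Fin 3, _ := fun m => sum_abar_mul_sub (M := M) k l q m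
    (fun i => G.potential (U k (Function.update q l i)) m)
  simp only [hab, Finset.sum_sub_distrib] at hin
  rw [Finset.sum_comm (s := Finset.univ (α := Fin 3)) (t := Finset.univ (α := Fin (p + 1)))] at hin
  simp only [Mesh.normal, FaceNode.sgn, FaceNode.side, FaceNode.elem, FaceNode.dir, FaceNode.node,
    atFace, if_true, Bool.false_eq_true, if_false, one_smul, neg_smul, Pi.neg_apply, neg_mul,
    Finset.sum_neg_distrib, neg_neg]
  simp only [mul_comm (G.potential _ _) (M.a _ _ _ _)] at hin
  linarith

theorem sum_line_viscous (w v : Node p → V5) (k : Fin K) (l : Fin 3) (q : Node p) :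
    ∑ i, S.P i * (w (Function.update q l i) ⬝ᵥ S.Dxi l v (Function.update q l i)) =
      (∑ i, faceSum (K := K) (fun x => x.sgn * (w x.node ⬝ᵥ v x.node)) k l
          (Function.update q l i))
      - ∑ i, S.P i * (S.Dxi l w (Function.update q l i) ⬝ᵥ v (Function.update q l i)) := by
  rw [sum_faceSum_line]
  have h (g : Node p → V5) (i : Fin (p + 1)) : S.P i • S.Dxi l g (Function.update q l i) =
      ∑ n, S.Q i n • g (Function.update q l n) := by
    have := S.P_smul_Dxi l g (Function.update q l i)
    simpa only [Function.update_self, Function.update_idem] using this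
  simp only [← smul_eq_mul (S.P _), ← dotProduct_smul (S.P _) (w _), ← smul_dotProduct (S.P _), h]
  rw [S.sum_dotProduct_Q_by_parts (fun i => w (Function.update q l i))]
  simp [FaceNode.sgn, FaceNode.side, FaceNode.node]
  ring

variable (G M f C A U) in
/-- The net entropy supplied at a face point. -/
def faceEntropy (x : FaceNode K p) : ℝ :=
  -(∑ m, M.normal x m * G.entropyFlux (atFace U x) m)
    + G.entropyVar (atFace U x) ⬝ᵥ (fluxVn G M C A U x + penTotal G M f C A U x)
    + (x.sgn • penΘ G M C A U x) ⬝ᵥ fluxVn G M C A U x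

theorem FaceNode.sgn_mul_self (x : FaceNode K p) : x.sgn * x.sgn = 1 := by
  unfold FaceNode.sgn; split_ifs <;> norm_num

variable (G M f C A U) in
/-- The contribution of the computational direction `l` to `w ⬝ᵥ d(JU)/dt` at a solution point,
multiplied by the one-dimensional weight. -/
def production (k : Fin K) (l : Fin 3) (q : Node p) : ℝ :=
  -(G.entropyVar (U k q) ⬝ᵥ
      (fluxTotal G M f C A U k l q (q l).succ - fluxTotal G M f C A U k l q (q l).castSucc))
    + S.P (q l) * (G.entropyVar (U k q) ⬝ᵥ S.Dxi l (fluxV G M C A U k l) q)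
    + G.entropyVar (U k q) ⬝ᵥ onFaces (penTotal G M f C A U) k l q

variable (G M f C A U) in
/-- The upper bound of `production` left by summation along a grid line: a metric term, the
dissipation by the viscous fluxes, and the entropy supplied at the two ends. -/
def productionBound (k : Fin K) (l : Fin 3) (q : Node p) : ℝ :=
  -(∑ m, G.potential (U k q) m * ∑ n, S.Q (q l) n * M.a k l (Function.update q l n) m)
    - S.P (q l) * (gradξ G M C A U k l q ⬝ᵥ fluxV G M C A U k l q)
    + faceSum (faceEntropy G M f C A U) k l q

/-- Summation by parts leaves the unpenalised gradient `D w`. Writing it as the penalised gradient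
minus `P⁻¹ g^Θ` prepares the dissipation term and sends the penalty to the faces. -/
theorem sum_line_production_le (hU : ∀ k q, G.Admissible (U k q)) (k : Fin K) (l : Fin 3)
    (q : Node p) : ∑ i, production G M f C A U k l (Function.update q l i) ≤
      ∑ i, productionBound G M f C A U k l (Function.update q l i) := by
  have h1 := sum_line_inviscid_le (M := M) (f := f) (C := C) (A := A) hU k l q
  have h2 := sum_line_viscous (K := K) (S := S) (fun q => G.entropyVar (U k q))
    (fluxV G M C A U k l) k l q
  have hgrad : ∀ i, S.P i * (S.Dxi l (fun q => G.entropyVar (U k q)) (Function.update q l i) ⬝ᵥ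
      fluxV G M C A U k l (Function.update q l i)) =
      S.P i * (gradξ G M C A U k l (Function.update q l i) ⬝ᵥ
        fluxV G M C A U k l (Function.update q l i))
      - faceSum (fun x => fluxV G M C A U x.elem x.dir x.node ⬝ᵥ penΘ G M C A U x) k l
        (Function.update q l i) := by
    intro i
    have h := dotProduct_onFaces (fun k q => fluxV G M C A U k l q) (penΘ G M C A U) k l
      (Function.update q l i)
    -- All face points met by `faceSum` in direction `l` have `dir = l` by definition.
    have h' : faceSum (fun x => fluxV G M C A U x.elem x.dir x.node ⬝ᵥ penΘ G M C A U x) k l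
        (Function.update q l i) = faceSum (fun x => fluxV G M C A U x.elem l x.node ⬝ᵥ
          penΘ G M C A U x) k l (Function.update q l i) := rfl
    rw [h', ← h, gradξ, add_dotProduct, smul_dotProduct, mul_add, smul_eq_mul,
      Function.update_self, mul_inv_cancel_left₀ (S.P_pos i).ne', dotProduct_comm (onFaces _ _ _ _),
      add_sub_cancel_right]
  have hface : ∀ q', faceSum (faceEntropy G M f C A U) k l q' =
      faceSum (fun x => -∑ m, M.normal x m * G.entropyFlux (atFace U x) m) k l q'
      + faceSum (fun x => x.sgn * (G.entropyVar (U k x.node) ⬝ᵥ fluxV G M C A U k l x.node)) k l q'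
      + faceSum (fun x => fluxV G M C A U x.elem x.dir x.node ⬝ᵥ penΘ G M C A U x) k l q'
      + G.entropyVar (U k q') ⬝ᵥ onFaces (penTotal G M f C A U) k l q' := by
    intro q'
    rw [dotProduct_onFaces (fun k q => G.entropyVar (U k q))]
    unfold faceSum
    simp only [← Finset.sum_add_distrib]
    refine Finset.sum_congr rfl fun s _ => ?_
    split_ifs with h
    · simp only [faceEntropy, fluxVn, dotProduct_add, dotProduct_smul, smul_dotProduct, smul_eq_mul]
      rw [← mul_assoc, FaceNode.sgn_mul_self, one_mul, dotProduct_comm (penΘ _ _ _ _ _ _)]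
      simp only [FaceNode.elem, FaceNode.node, FaceNode.dir, atFace]
      ring
    · simp
  simp only [hgrad] at h2
  simp only [production, productionBound, Function.update_self, Function.update_idem,
    fluxTotal_update, hface,
    Finset.sum_add_distrib, Finset.sum_sub_distrib, Finset.sum_neg_distrib] at h1 h2 ⊢
  linarith

end

section

variable {G : Gas} {p K : ℕ} {S : SBP p} {M : Mesh S K} {f : TwoPointFlux G} {C : Params M}
  {A : Fields K p} {U : State K p}

/-! ### Entropy balance at element interfaces -/

theorem TwoPointFlux.along_neg (f : TwoPointFlux G) {u₁ u₂ : V5} (h₁ : G.Admissible u₁)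
    (h₂ : G.Admissible u₂) (n : V3) : f.along u₂ u₁ (-n) = -f.along u₁ u₂ n := by
  simp [TwoPointFlux.along, f.symm u₂ u₁ h₂ h₁]

/-- Both sides of an interface see the same numerical flux up to orientation, so their sum involves
only the jump of `w`. -/
theorem fluxMR_neg {u₁ u₂ : V5} (h₁ : G.Admissible u₁) (h₂ : G.Admissible u₂) (n : V3) :
    fluxMR G f u₂ u₁ (-n) = -fluxMR G f u₁ u₂ n := by
  unfold fluxMR
  rw [f.along_neg h₁ h₂, G.roeMatrix_comm, ← neg_sub (G.entropyVar u₂), mulVec_neg]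
  abel

theorem jumpPrim_comm (u₁ u₂ : V5) (J₁ J₂ : ℝ) :
    jumpPrim G u₂ u₁ J₂ J₁ = -jumpPrim G u₁ u₂ J₁ J₂ := by
  rw [jumpPrim, jumpPrim, ← smul_neg, neg_sub, mul_comm]

theorem Mesh.normal_nbr {x y : FaceNode K p} (h : M.nbr x = some y) : M.normal y = -M.normal x :=
  M.nbr_normal x y h

theorem penAD_comm {x y : FaceNode K p} (h : M.nbr x = some y) :
    penAD G M C A U y x = -penAD G M C A U x y := by
  have hP : S.P (y.node y.dir) = S.P (x.node x.dir) := by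
    have hx : x.node x.dir = endIdx p x.side := x.2
    have hy : y.node y.dir = endIdx p y.side := y.2
    rw [hx, hy, S.P_endIdx]
  unfold penAD
  rw [M.normal_nbr h, hP, jumpPrim_comm, add_comm (A.μAD y.elem y.node)]
  simp only [G.brenner_comm, mulVec_neg, smul_neg]

theorem dotProduct_penAD_nonneg (hU : ∀ k q, G.Admissible (U k q)) (x y : FaceNode K p) :
    0 ≤ (G.entropyVar (atFace U y) - G.entropyVar (atFace U x)) ⬝ᵥ penAD G M C A U x y := by
  have hμ := avg_μAD_nonneg (A := A) x.elem y.elem x.node y.node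
  exact dotProduct_brenner_jumpPrim_nonneg (hU _ _) (hU _ _) _ (mul_nonneg C.cρ_pos.le hμ) hμ
    (mul_nonneg C.cT_pos.le hμ) (S.P_pos _).le _ _

/-- The inviscid part is the jump of `w` against the Roe flux minus the jump of `ψ`, hence minus a
Roe dissipation. As `α` changes sign between the sides, the coefficients of both viscous normal
fluxes sum to zero. The `β` and Brenner penalties are antisymmetric under exchange and contribute
minus a nonnegative form in the jump. -/
theorem faceEntropy_add_nonpos (hU : ∀ k q, G.Admissible (U k q)) {x y : FaceNode K p}
    (h : M.nbr x = some y) :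
    faceEntropy G M f C A U x + faceEntropy G M f C A U y ≤ 0 := by
  have h' := M.nbr_symm x y h
  have hu : G.Admissible (atFace U x) := hU _ _
  have hv : G.Admissible (atFace U y) := hU _ _
  simp only [faceEntropy, penTotal, penΘ, h, h', penInterface, smul_smul, ← mul_assoc,
    FaceNode.sgn_mul_self, one_mul, penAD_comm h, C.α_antisymm x y h, C.β_symm x y h,
    M.normal_nbr h, fluxMR_neg hu hv]
  rw [← neg_sub (G.entropyVar (atFace U y)), G.viscNormal_neg_neg, G.viscNormal_neg_neg,
    add_comm (fluxVn G M C A U y), dotProduct_add, dotProduct_add, dotProduct_add, dotProduct_add,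
    dotProduct_add, dotProduct_add, dotProduct_sub, dotProduct_sub, dotProduct_sub, dotProduct_sub,
    dotProduct_sum_invFlux, dotProduct_sum_invFlux]
  have hMR : (G.entropyVar (atFace U y) - G.entropyVar (atFace U x)) ⬝ᵥ
      fluxMR G f (atFace U x) (atFace U y) (M.normal x) ≤
      ∑ m, M.normal x m * (G.potential (atFace U y) m - G.potential (atFace U x) m) := by
    rw [fluxMR, dotProduct_sub, f.sub_dotProduct_along hu hv]
    linarith [G.roeMatrix_nonneg (atFace U x) (atFace U y) (M.normal x)
      (G.entropyVar (atFace U y) - G.entropyVar (atFace U x))]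
  have hAD := dotProduct_penAD_nonneg (M := M) (C := C) (A := A) hU x y
  have hIP : 0 ≤ (G.entropyVar (atFace U y) - G.entropyVar (atFace U x)) ⬝ᵥ ((C.β x / 2) •
      ((M.J x.elem x.node)⁻¹ • viscNormal G (atFace U x) (M.normal x)
          (G.entropyVar (atFace U y) - G.entropyVar (atFace U x))
        + (M.J y.elem y.node)⁻¹ • viscNormal G (atFace U y) (M.normal x)
          (G.entropyVar (atFace U y) - G.entropyVar (atFace U x)))) := by
    have h1 := G.dotProduct_viscNormal_nonneg hu (M.normal x)
      (G.entropyVar (atFace U y) - G.entropyVar (atFace U x))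
    have h2 := G.dotProduct_viscNormal_nonneg hv (M.normal x)
      (G.entropyVar (atFace U y) - G.entropyVar (atFace U x))
    have := M.J_pos x.elem x.node
    have := M.J_pos y.elem y.node
    have := C.β_nonneg x
    simp only [dotProduct_smul, dotProduct_add, smul_eq_mul]
    positivity
  generalize hδ : G.entropyVar (atFace U y) - G.entropyVar (atFace U x) = δ at *
  have hB : (C.β x / 2) • ((M.J y.elem y.node)⁻¹ • -viscNormal G (atFace U y) (M.normal x) δ
      + (M.J x.elem x.node)⁻¹ • -viscNormal G (atFace U x) (M.normal x) δ) =
      -((C.β x / 2) • ((M.J x.elem x.node)⁻¹ • viscNormal G (atFace U x) (M.normal x) δ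
        + (M.J y.elem y.node)⁻¹ • viscNormal G (atFace U y) (M.normal x) δ)) := by
    module
  rw [hB]
  generalize (C.β x / 2) • (_ + _ : V5) = B at *
  subst hδ
  simp only [mul_sub, Finset.sum_sub_distrib] at hMR
  simp only [sub_dotProduct, dotProduct_smul, smul_dotProduct, dotProduct_neg, neg_dotProduct,
    dotProduct_add, smul_eq_mul, Pi.neg_apply, neg_mul, Finset.sum_neg_distrib] at *
  linarith

theorem faceEntropy_boundary {x : FaceNode K p} (h : M.nbr x = none) :
    faceEntropy G M f C A U x = -(∑ m, M.normal x m * G.entropyFlux (atFace U x) m)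
      + G.entropyVar (atFace U x) ⬝ᵥ (fluxVn G M C A U x + A.pen x)
      + A.gradPen x ⬝ᵥ fluxVn G M C A U x := by
  simp only [faceEntropy, penTotal, penΘ, h, smul_smul, FaceNode.sgn_mul_self, one_smul]

/-- Boundary points are split off; the rest is summed twice, once along the matching involution, so
that partners meet. Equal surface weights make the pairwise estimate applicable. -/
theorem sum_faceEntropy_nonpos (hU : ∀ k q, G.Admissible (U k q))
    (hbc : boundaryEntropy G M C A U ≤ 0) :
    ∑ x, x.weight S * faceEntropy G M f C A U x ≤ 0 := by
  set T : FaceNode K p → ℝ := fun x =>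
    if M.nbr x = none then 0 else x.weight S * faceEntropy G M f C A U x with hT
  have hsplit : ∑ x, x.weight S * faceEntropy G M f C A U x =
      boundaryEntropy G M C A U + ∑ x, T x := by
    rw [boundaryEntropy, ← Finset.sum_add_distrib]
    refine Finset.sum_congr rfl fun x _ => ?_
    by_cases h : M.nbr x = none
    · simp only [hT, if_pos h, faceEntropy_boundary h, add_zero]
    · simp only [hT, if_neg h, zero_add]
  -- Unmatched points are fixed by `σ`, where `T` vanishes.
  let σ : FaceNode K p → FaceNode K p := fun x => (M.nbr x).getD x
  have hσ : Function.Involutive σ := by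
    intro x
    rcases h : M.nbr x with _ | y
    · simp [σ, h]
    · simp [σ, h, M.nbr_symm x y h]
  have hsum : ∑ x, T (σ x) = ∑ x, T x := Equiv.sum_comp (hσ.toPerm σ) T
  have hpair : ∑ x, (T x + T (σ x)) ≤ 0 := by
    refine Finset.sum_nonpos fun x _ => ?_
    rcases h : M.nbr x with _ | y
    · simp [σ, T, h]
    · have hw : 0 ≤ x.weight S := (S.perp_pos x.dir x.node).le
      have := mul_nonpos_of_nonneg_of_nonpos hw
        (faceEntropy_add_nonpos (f := f) (C := C) (A := A) hU h)
      simp only [σ, T, h, Option.getD_some, M.nbr_symm x y h, reduceCtorEq, if_false,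
        M.nbr_weight x y h]
      linarith
  rw [Finset.sum_add_distrib, hsum] at hpair
  linarith

/-! ### Global entropy balance -/

/-- The same metric coefficients build the Cartesian gradient and the contravariant flux, so the
computational contraction is `J` times the physical one. -/
theorem sum_gradξ_dotProduct_fluxV_nonneg (hU : ∀ k q, G.Admissible (U k q)) (k : Fin K)
    (q : Node p) : 0 ≤ ∑ l, gradξ G M C A U k l q ⬝ᵥ fluxV G M C A U k l q := by
  have hJ := M.J_pos k q
  have h : ∑ l, gradξ G M C A U k l q ⬝ᵥ fluxV G M C A U k l q =
      M.J k q * ∑ m, gradx G M C A U k q m ⬝ᵥ G.viscFlux (U k q) (gradx G M C A U k q) m := by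
    have hg : ∀ m, M.J k q • gradx G M C A U k q m =
        ∑ l, M.a k l q m • gradξ G M C A U k l q := fun m => by
      rw [gradx, smul_smul, mul_inv_cancel₀ hJ.ne', one_smul]
    rw [Finset.mul_sum]
    simp only [← smul_eq_mul (M.J k q), ← smul_dotProduct (M.J k q), hg]
    simp only [fluxV, dotProduct_sum, sum_dotProduct, dotProduct_smul, smul_dotProduct]
    exact Finset.sum_comm
  rw [h]
  exact mul_nonneg hJ.le (G.sum_dotProduct_viscFlux_nonneg (hU k q) _)

theorem vol_mul_dotProduct_rhs (k : Fin K) (q : Node p) :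
    S.vol q * (G.entropyVar (U k q) ⬝ᵥ rhs G M f C A U k q) =
      ∑ l, S.perp l q * production G M f C A U k l q := by
  rw [rhs, dotProduct_sum, Finset.mul_sum]
  refine Finset.sum_congr rfl fun l _ => ?_
  have hP := (S.P_pos (q l)).ne'
  rw [S.vol_eq l, production]
  simp only [dotProduct_add, dotProduct_neg, dotProduct_smul, smul_eq_mul]
  field_simp

/-- Since `perp · Q = vol · D`, the weights become independent of `l`; the geometric conservation
law then applies for each `m`. -/
theorem sum_metric_eq_zero (k : Fin K) (q : Node p) (ψ : Fin 3 → ℝ) :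
    ∑ l, S.perp l q * ∑ m, ψ m * ∑ n, S.Q (q l) n * M.a k l (Function.update q l n) m = 0 := by
  have h : ∀ l, S.perp l q * ∑ m, ψ m * ∑ n, S.Q (q l) n * M.a k l (Function.update q l n) m =
      ∑ m, S.vol q * ψ m * ∑ n, S.D (q l) n * M.a k l (Function.update q l n) m := by
    intro l
    have hP := (S.P_pos (q l)).ne'
    rw [S.vol_eq l, Finset.mul_sum]
    refine Finset.sum_congr rfl fun m _ => ?_
    simp only [Finset.mul_sum, SBP.D]
    refine Finset.sum_congr rfl fun n _ => ?_
    field_simp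
  rw [Finset.sum_congr rfl fun l _ => h l, Finset.sum_comm]
  refine Finset.sum_eq_zero fun m _ => ?_
  rw [← Finset.mul_sum, M.gcl, mul_zero]

theorem sum_vol_mul_dotProduct_rhs_nonpos (hU : ∀ k q, G.Admissible (U k q))
    (hbc : boundaryEntropy G M C A U ≤ 0) :
    ∑ k, ∑ q, S.vol q * (G.entropyVar (U k q) ⬝ᵥ rhs G M f C A U k q) ≤ 0 := by
  have h1 : ∀ k, ∑ q, S.vol q * (G.entropyVar (U k q) ⬝ᵥ rhs G M f C A U k q) ≤
      ∑ l, ∑ q, S.perp l q * productionBound G M f C A U k l q := by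
    intro k
    simp only [vol_mul_dotProduct_rhs]
    rw [Finset.sum_comm]
    refine Finset.sum_le_sum fun l _ => sum_node_le_of_lines l fun q => ?_
    -- The transverse weight is constant along the line and factors out of the one-dimensional
    -- estimate.
    simp only [S.perp_update, ← Finset.mul_sum]
    exact mul_le_mul_of_nonneg_left (sum_line_production_le hU k l q) (S.perp_pos l q).le
  have h2 : ∀ k, ∑ l, ∑ q, S.perp l q * productionBound G M f C A U k l q ≤
      ∑ l, ∑ q, S.perp l q * faceSum (faceEntropy G M f C A U) k l q := by
    intro k
    -- From lines back to points: the metric and viscous terms are controlled only after summing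
    -- over `l` at a fixed `q`.
    rw [Finset.sum_comm, Finset.sum_comm (s := Finset.univ (α := Fin 3))]
    refine Finset.sum_le_sum fun q _ => ?_
    have hm := sum_metric_eq_zero (M := M) k q (G.potential (U k q))
    have hv := mul_nonneg (S.vol_pos q).le
      (sum_gradξ_dotProduct_fluxV_nonneg (M := M) (C := C) (A := A) hU k q)
    rw [Finset.mul_sum, Finset.sum_congr rfl fun l _ => by rw [S.vol_eq l, mul_assoc]] at hv
    simp only [productionBound, mul_add, mul_sub, mul_neg, Finset.sum_add_distrib,
      Finset.sum_sub_distrib, Finset.sum_neg_distrib, hm]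
    linarith
  calc _ ≤ ∑ k, ∑ l, ∑ q, S.perp l q * faceSum (faceEntropy G M f C A U) k l q :=
        Finset.sum_le_sum fun k _ => (h1 k).trans (h2 k)
    _ = ∑ x, x.weight S * faceEntropy G M f C A U x := sum_perp_mul_faceSum S _
    _ ≤ 0 := sum_faceEntropy_nonpos hU hbc

end

/-! ### Time derivative of the total entropy -/

theorem hasDerivWithinAt_totalEntropy {G : Gas} {p K : ℕ} {S : SBP p} {M : Mesh S K}
    {f : TwoPointFlux G} {C : Params M} {A : ℝ → Fields K p} {I : Set ℝ} {U : ℝ → State K p}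
    (hadm : ∀ t ∈ I, ∀ k q, G.Admissible (U t k q)) (hsol : IsSolution G M f C A I U)
    {t : ℝ} (ht : t ∈ I) :
    HasDerivWithinAt (fun τ => totalEntropy G M (U τ))
      (∑ k, ∑ q, S.vol q * (G.entropyVar (U t k q) ⬝ᵥ rhs G M f C (A t) (U t) k q)) I t := by
  unfold totalEntropy
  refine HasDerivWithinAt.fun_sum fun k _ => HasDerivWithinAt.fun_sum fun q _ => ?_
  have hJ := (M.J_pos k q).ne'
  have hu : HasDerivWithinAt (fun τ => U τ k q)
      ((M.J k q)⁻¹ • rhs G M f C (A t) (U t) k q) I t := by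
    simpa only [Pi.smul_def, smul_smul, inv_mul_cancel₀ hJ, one_smul] using
      (hsol t ht k q).const_smul (M.J k q)⁻¹
  -- The static `J` in the quadrature weight cancels the `J⁻¹` from solving for the derivative of
  -- `U`.
  refine ((G.hasDerivWithinAt_entropy hu (hadm t ht k q)).const_mul _).congr_deriv ?_
  rw [dotProduct_smul, smul_eq_mul]
  field_simp

end NSScheme

end

open NSScheme
theorem mainTheorem2 (G : Gas) {p K : ℕ} (hp : 1 ≤ p) (S : SBP p) (M : Mesh S K)
    (f : TwoPointFlux G) (C : Params M) (A : ℝ → Fields K p)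
    (I : Set ℝ) (hI : I.OrdConnected) (U : ℝ → State K p)
    (hadm : ∀ t ∈ I, ∀ k q, G.Admissible (U t k q))
    (hsol : IsSolution G M f C A I U)
    (hbc : ∀ t ∈ I, boundaryEntropy G M C (A t) (U t) ≤ 0) :
    (∀ t ∈ I, ∃ e : ℝ, e ≤ 0 ∧
      HasDerivWithinAt (fun τ => totalEntropy G M (U τ)) e I t) ∧
    AntitoneOn (fun τ => totalEntropy G M (U τ)) I := by
  have hd := fun t (ht : t ∈ I) => hasDerivWithinAt_totalEntropy hadm hsol ht
  have hn := fun t (ht : t ∈ I) => sum_vol_mul_dotProduct_rhs_nonpos (f := f) (hadm t ht) (hbc t ht)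
  refine ⟨fun t ht => ⟨_, hn t ht, hd t ht⟩, ?_⟩
  exact antitoneOn_of_hasDerivWithinAt_nonpos hI.convex
    (fun t ht => (hd t ht).continuousWithinAt)
    (fun t ht => (hd t (interior_subset ht)).mono interior_subset)
    (fun t ht => hn t (interior_subset ht))
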